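/- Setting. Let $(\Omega,\mathcal F,\mathbb P)$ be a probability space and consider a one-period market with a riskless asset $S^0_0=1$, $S^0_1=1+r$, $r>-1$, and risky assets $S^1,\dots,S^d$ with prices $S^i_0>0$ at time $0$ and real-valued random variables $S^i_1$ at time $1$. Let $R^i=(S^i_1-S^i_0)/S^i_0$. The market is nonredundant ($\sum_{i=0}^d\theta^iS^i_t=0$ $\mathbb P$-a.s. for $t=0,1$ implies $\theta=0$) and nondegenerate ($\mathbb E[R^i]\neq r$ for some $i\in\{1,\dots,d\}$). A portfolio $\pi\in\mathbb R^d$ has excess return $X_\pi=\sum_{i=1}^d\pi^i(R^i-r)$. For a map $\rho$ from a vector space of random variables containing all $X_\pi$ to $[-\infty,\infty]$ and $\nu\ge 0$, let $\Pi^\rho_\nu$ be the set of $\pi$ with $\mathbb E[X_\pi]=\nu$, $\rho(X_\pi)<\infty$ and $\rho(X_\pi)\le\rho(X_{\pi'})$ for all $\pi'$ with $\mathbb E[X_{\pi'}]=\nu$. A portfolio $\pi$ is $\rho$-efficient if $\mathbb E[X_\pi]\ge0$ and there is no $\pi'$ with $\mathbb E[X_{\pi'}]\ge\mathbb E[X_\pi]$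 and $\rho(X_{\pi'})\le\rho(X_\pi)$, one of the two inequalities being strict. The market admits $\rho$-arbitrage if there is no $\rho$-efficient portfolio; it admits strong $\rho$-arbitrage if for every $\pi$ there is $\pi'$ with $\mathbb E[X_{\pi'}]>\mathbb E[X_\pi]$ and $\rho(X_{\pi'})<\rho(X_\pi)$. Let $\mathcal D=\{Z\in L^1: Z\ge0\ \mathbb P\text{-a.s.},\ \mathbb E[Z]=1\}$, $\mathcal M=\{Z\in\mathcal D: Z(R^i-r)\in L^1\text{ and }\mathbb E[Z(R^i-r)]=0\text{ for } i=1,\dots,d\}$ and $\mathcal P=\{Z\in\mathcal M: Z>0\ \mathbb P\text{-a.s.}\}$. Let $\Phi:[0,\infty)\to[0,\infty)$ be a finite Young function (convex, $\lim_{x\downarrow0}\Phi(x)=\Phi(0)=0$, $\lim_{x\to\infty}\Phi(x)=\infty$) that is superlinear ($\Phi(x)/x\to\infty$ as $x\to\infty$), with conjugate $\Psi(y)=\sup_{x\ge0}\{xy-\Phi(x)\}$. Let $L^\Phi$ be the set of random variables $X$ with $\mathbb E[\Phi(c|X|)]<\infty$ for some $c>0$, and $H^\Phi$ the set of those for which this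 holds for all $c>0$. Let $g:[0,\infty)\to[0,\infty)$ be convex with $g\ge\Psi$ on $[0,\infty)$, let $\beta>g(1)$, and let $$\rho^{g,\beta}(X)=\sup\{\mathbb E[-ZX]: Z\in\mathcal D,\ \mathbb E[g(Z)]\le\beta\},\qquad X\in L^\Phi.$$ Suppose that $R^i\in L^\Phi$ for all $i\in\{1,\dots,d\}$. Theorem. For every $\nu\ge0$ the set $\Pi^{\rho^{g,\beta}}_\nu$ is nonempty, compact and convex. Moreover: (a) If $R^i\in H^\Phi$ for all $i$, and $g$ is continuous at $0$, then the market does not admit strong $\rho^{g,\beta}$-arbitrage if and only if there is $Z\in\mathcal M$ with $\mathbb E[g(Z)]\le\beta$. (b) The market does not admit $\rho^{g,\beta}$-arbitrage if and only if there is $Z\in\mathcal P$ with $\mathbb E[g(Z)]<\beta$. -/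

import Mathlib

open MeasureTheory Filter Topology Set
open scoped ENNReal

noncomputable section

namespace MeanRisk

/-! ### Young functions, Orlicz spaces and Orlicz hearts -/

/-- A finite Young function `Φ : [0, ∞) → [0, ∞)`. Only the values of `Φ` on `[0, ∞)` matter. -/
structure IsFiniteYoung (Φ : ℝ → ℝ) : Prop where
  convexOn : ConvexOn ℝ (Ici 0) Φ
  nonneg : ∀ x, 0 ≤ x → 0 ≤ Φ x
  map_zero : Φ 0 = 0
  tendsto_zero : Tendsto Φ (𝓝[>] 0) (𝓝 0)
  tendsto_atTop : Tendsto Φ atTop atTop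

/-- `Φ(x) / x → ∞` as `x → ∞`. -/
def IsSuperlinear (Φ : ℝ → ℝ) : Prop :=
  Tendsto (fun x => Φ x / x) atTop atTop

/-- The convex conjugate `Ψ(y) = sup_{x ≥ 0} (x y - Φ(x))`, with values in `[-∞, ∞]`. -/
def youngConjugate (Φ : ℝ → ℝ) (y : ℝ) : EReal :=
  ⨆ x ∈ Ici (0 : ℝ), ((x * y - Φ x : ℝ) : EReal)

/-- `g` dominates the conjugate `Ψ` of `Φ`: `Ψ(y) ≤ g(y)` for all `y ≥ 0`. -/
def DominatesConjugate (g Φ : ℝ → ℝ) : Prop :=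
  ∀ y : ℝ, 0 ≤ y → youngConjugate Φ y ≤ (g y : EReal)

variable {Ω : Type*} [MeasurableSpace Ω]

/-- `E[f(Y)]` in `[0, ∞]`, for a function `f` that is nonnegative at almost all values of `Y`. -/
def nnExpectation (P : Measure Ω) (f : ℝ → ℝ) (Y : Ω → ℝ) : ℝ≥0∞ :=
  ∫⁻ ω, ENNReal.ofReal (f (Y ω)) ∂P

/-- `X ∈ L^Φ`: `E[Φ(c|X|)] < ∞` for some `c > 0`. -/
def MemOrlicz (P : Measure Ω) (Φ : ℝ → ℝ) (X : Ω → ℝ) : Prop :=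
  AEMeasurable X P ∧ ∃ c : ℝ, 0 < c ∧ nnExpectation P Φ (fun ω => c * |X ω|) < ⊤

/-- `X ∈ H^Φ`: `X ∈ L^Φ` and `E[Φ(c|X|)] < ∞` for all `c > 0`. -/
def MemOrliczHeart (P : Measure Ω) (Φ : ℝ → ℝ) (X : Ω → ℝ) : Prop :=
  MemOrlicz P Φ X ∧ ∀ c : ℝ, 0 < c → nnExpectation P Φ (fun ω => c * |X ω|) < ⊤

/-! ### Densities and `g`-entropic risk measures -/

/-- The set `𝒟` of densities of probability measures that are absolutely continuous
with respect to `P`. -/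
def densities (P : Measure Ω) : Set (Ω → ℝ) :=
  {Z | Integrable Z P ∧ (∀ᵐ ω ∂P, 0 ≤ Z ω) ∧ ∫ ω, Z ω ∂P = 1}

/-- The extended expectation `E[Y] = E[Y⁺] - E[Y⁻]`, equal to `∞` if `E[Y⁺] = ∞`. -/
def extExpectation (P : Measure Ω) (Y : Ω → ℝ) : EReal :=
  if ∫⁻ ω, ENNReal.ofReal (Y ω) ∂P = ⊤ then ⊤
  else ((∫⁻ ω, ENNReal.ofReal (Y ω) ∂P : ℝ≥0∞) : EReal)
    - ((∫⁻ ω, ENNReal.ofReal (-Y ω) ∂P : ℝ≥0∞) : EReal)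

/-- `𝒬^{g,β} = {Z ∈ 𝒟 : E[g(Z)] ≤ β}`. -/
def entropicDualSet (P : Measure Ω) (g : ℝ → ℝ) (β : ℝ) : Set (Ω → ℝ) :=
  {Z | Z ∈ densities P ∧ nnExpectation P g Z ≤ ENNReal.ofReal β}

/-- The `g`-entropic risk measure `ρ^{g,β}(X) = sup_{Z ∈ 𝒬^{g,β}} E[-Z X]`. -/
def entropicRisk (P : Measure Ω) (g : ℝ → ℝ) (β : ℝ) (X : Ω → ℝ) : EReal :=
  ⨆ Z ∈ entropicDualSet P g β, extExpectation P (fun ω => -(Z ω * X ω))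

/-! ### The market -/

/-- A one-period market with a riskless asset, of price `1` at time `0` and `1 + r` at time `1`,
and risky assets indexed by `Fin d`, of price `S₀ i` at time `0` and `S₁ i` at time `1`. -/
structure Market (Ω : Type*) [MeasurableSpace Ω] (d : ℕ) where
  r : ℝ
  neg_one_lt_r : -1 < r
  S₀ : Fin d → ℝ
  S₀_pos : ∀ i, 0 < S₀ i
  S₁ : Fin d → Ω → ℝ
  measurable_S₁ : ∀ i, Measurable (S₁ i)

namespace Market

variable {d : ℕ} (m : Market Ω d) (P : Measure Ω)

/-- The return `R^i = (S^i_1 - S^i_0) / S^i_0`. -/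
def ret (i : Fin d) (ω : Ω) : ℝ := (m.S₁ i ω - m.S₀ i) / m.S₀ i

/-- A portfolio of all `1 + d` assets that is worth zero at time `0` and, almost surely,
at time `1` is the zero portfolio. -/
def Nonredundant : Prop :=
  ∀ (θ₀ : ℝ) (θ : Fin d → ℝ), θ₀ * 1 + ∑ i, θ i * m.S₀ i = 0 →
    (∀ᵐ ω ∂P, θ₀ * (1 + m.r) + ∑ i, θ i * m.S₁ i ω = 0) → θ₀ = 0 ∧ θ = 0

/-- Some risky asset has an expected return different from `r`. -/
def Nondegenerate : Prop := ∃ i, ∫ ω, m.ret i ω ∂P ≠ m.r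

/-- The return `R_π = (1 - π · 𝟏) r + π · R` of the portfolio with risky fractions `π`. -/
def portfolioReturn (π : Fin d → ℝ) (ω : Ω) : ℝ :=
  (1 - ∑ i, π i) * m.r + ∑ i, π i * m.ret i ω

/-- The excess return `X_π = R_π - r`. -/
def excessReturn (π : Fin d → ℝ) (ω : Ω) : ℝ := m.portfolioReturn π ω - m.r

/-- The expected excess return `E[X_π]`. -/
def expectedExcess (π : Fin d → ℝ) : ℝ := ∫ ω, m.excessReturn π ω ∂P

/-- The set `Π_ν` of portfolios with expected excess return `ν`. -/
def portfolios (ν : ℝ) : Set (Fin d → ℝ) := {π | m.expectedExcess P π = ν}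

/-- The set `Π^ρ_ν` of `ρ`-optimal portfolios for `ν`. -/
def optimalPortfolios (ρ : (Ω → ℝ) → EReal) (ν : ℝ) : Set (Fin d → ℝ) :=
  {π | π ∈ m.portfolios P ν ∧ ρ (m.excessReturn π) < ⊤ ∧
    ∀ π' ∈ m.portfolios P ν, ρ (m.excessReturn π) ≤ ρ (m.excessReturn π')}

/-- `π` is strictly `ρ`-preferred over `π'`. -/
def StrictlyPreferred (ρ : (Ω → ℝ) → EReal) (π π' : Fin d → ℝ) : Prop :=
  m.expectedExcess P π' ≤ m.expectedExcess P π ∧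
    ρ (m.excessReturn π) ≤ ρ (m.excessReturn π') ∧
    (m.expectedExcess P π' < m.expectedExcess P π ∨
      ρ (m.excessReturn π) < ρ (m.excessReturn π'))

/-- `π` is `ρ`-efficient. -/
def Efficient (ρ : (Ω → ℝ) → EReal) (π : Fin d → ℝ) : Prop :=
  0 ≤ m.expectedExcess P π ∧ ¬ ∃ π', m.StrictlyPreferred P ρ π' π

/-- `ρ`-arbitrage: there are no `ρ`-efficient portfolios. -/
def RhoArbitrage (ρ : (Ω → ℝ) → EReal) : Prop := ¬ ∃ π, m.Efficient P ρ π

/-- Strong `ρ`-arbitrage: every portfolio can be improved strictly both in expected return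
and in risk. -/
def StrongRhoArbitrage (ρ : (Ω → ℝ) → EReal) : Prop :=
  ∀ π, ∃ π', m.expectedExcess P π < m.expectedExcess P π' ∧
    ρ (m.excessReturn π') < ρ (m.excessReturn π)

/-- The set `ℳ` of densities of absolutely continuous martingale measures. -/
def martingaleDensities : Set (Ω → ℝ) :=
  {Z | Z ∈ densities P ∧ ∀ i, Integrable (fun ω => Z ω * (m.ret i ω - m.r)) P ∧
    ∫ ω, Z ω * (m.ret i ω - m.r) ∂P = 0}

/-- The set `𝒫` of densities of equivalent martingale measures. -/
def equivalentMartingaleDensities : Set (Ω → ℝ) :=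
  {Z | Z ∈ m.martingaleDensities P ∧ ∀ᵐ ω ∂P, 0 < Z ω}

end Market

end MeanRisk

end

/-! Everything reduces to convex geometry in `ℝ^d`. Let `K` be the set of vectors `-E[Z(R - r)]`,
where `Z` runs over the densities with `E[g(Z)] ≤ β`, and let `μ = E[R - r]`. Young's inequality
makes `K` bounded, convexity of `g` makes it convex, and `Z = 1` shows `-μ ∈ K`. The risk of `X_π`
is the support function `σ` of `K` at `π`, and its mean is `π · μ`.

The probabilistic input is a perturbation argument (`EntropicModel.supportFun_pos`). If `Z > 0` has
entropy below `β`, `π ≠ 0` and `E[Z X_π] = 0`, then nonredundancy makes `X_π` nonzero with both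
signs, so moving some mass of `Z` from gains to losses gives a density of finite entropy with
negative expectation. A small admixture of it stays below `β`, hence `σ(π) > 0`. With `Z = 1` this
gives `σ > 0` on the nonzero vectors of `μ^⊥`, so `σ` is coercive on each hyperplane `π · μ = ν`,
and its minimizers there form a nonempty compact convex set.

For (b), efficient portfolios exist exactly when `σ > 0` away from `0`. Then `0` is interior to `K`,
so some `tμ ∈ K` with `t > 0`; mixing its density with `1` cancels the mean and yields a strictly
positive martingale density of entropy below `β`. The converse is the perturbation argument again.

For (a), strong arbitrage means that `σ` is negative somewhere, and `σ ≥ 0` forces `0 ∈ closure K`.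
To realize `0` by an actual density, a Komlós-type selection extracts an almost surely convergent
sequence from densities with vanishing loss vectors. Fatou's lemma preserves the entropy bound, and
the Orlicz heart assumption passes the expectations to the limit. -/

namespace MeanRisk

/-! ### Support functions of bounded sets in finite dimension -/

section SupportFunction

variable {ι : Type*} [Fintype ι]

/-- The support function `x ↦ sup_{k ∈ K} x · k`. -/
noncomputable def supportFun (K : Set (ι → ℝ)) (x : ι → ℝ) : ℝ :=
  sSup ((fun k => x ⬝ᵥ k) '' K)

theorem exists_dotProduct_eq (f : (ι → ℝ) →ₗ[ℝ] ℝ) : ∃ x : ι → ℝ, ∀ k, f k = x ⬝ᵥ k := by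
  classical
  refine ⟨fun i => f fun j => if i = j then 1 else 0, fun k => ?_⟩
  rw [LinearMap.pi_apply_eq_sum_univ f k]
  simp [dotProduct, mul_comm]

theorem continuous_dotProduct_right (x : ι → ℝ) : Continuous fun k : ι → ℝ => x ⬝ᵥ k := by
  unfold dotProduct
  fun_prop

variable {K : Set (ι → ℝ)}

theorem bddAbove_dotProduct_image (hK : Bornology.IsBounded K) (x : ι → ℝ) :
    BddAbove ((fun k => x ⬝ᵥ k) '' K) :=
  ((hK.isCompact_closure.image (continuous_dotProduct_right x)).bddAbove).mono
    (image_mono subset_closure)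

theorem dotProduct_le_supportFun (hK : Bornology.IsBounded K) (x : ι → ℝ) {k : ι → ℝ}
    (hk : k ∈ K) : x ⬝ᵥ k ≤ supportFun K x :=
  le_csSup (bddAbove_dotProduct_image hK x) (mem_image_of_mem _ hk)

theorem supportFun_le (hne : K.Nonempty) {x : ι → ℝ} {c : ℝ} (h : ∀ k ∈ K, x ⬝ᵥ k ≤ c) :
    supportFun K x ≤ c :=
  csSup_le (hne.image _) (by rintro _ ⟨k, hk, rfl⟩; exact h k hk)

theorem supportFun_add_le (hK : Bornology.IsBounded K) (hne : K.Nonempty) (x y : ι → ℝ) :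
    supportFun K (x + y) ≤ supportFun K x + supportFun K y :=
  supportFun_le hne fun k hk => by
    rw [add_dotProduct]
    exact add_le_add (dotProduct_le_supportFun hK x hk) (dotProduct_le_supportFun hK y hk)

theorem supportFun_smul {t : ℝ} (ht : 0 ≤ t) (x : ι → ℝ) :
    supportFun K (t • x) = t * supportFun K x := by
  unfold supportFun
  rw [← smul_eq_mul, ← Real.sSup_smul_of_nonneg ht, ← image_smul, image_image]
  simp only [smul_dotProduct]

theorem supportFun_zero : supportFun K (0 : ι → ℝ) = 0 := by
  simpa using supportFun_smul (K := K) le_rfl (0 : ι → ℝ)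

theorem convexOn_supportFun (hK : Bornology.IsBounded K) (hne : K.Nonempty) :
    ConvexOn ℝ univ (supportFun K) :=
  ⟨convex_univ, fun x _ y _ a b ha hb _ => by
    rw [smul_eq_mul, smul_eq_mul, ← supportFun_smul ha, ← supportFun_smul hb]
    exact supportFun_add_le hK hne _ _⟩

theorem continuous_supportFun (hK : Bornology.IsBounded K) (hne : K.Nonempty) :
    Continuous (supportFun K) :=
  (convexOn_supportFun hK hne).locallyLipschitz.continuous

/-- A hyperplane strictly separating `0` from the closure would have a normal at which the support
function is negative. -/
theorem zero_mem_closure_of_supportFun_nonneg (hne : K.Nonempty)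
    (hconv : Convex ℝ K) (h : ∀ x, 0 ≤ supportFun K x) : (0 : ι → ℝ) ∈ closure K := by
  by_contra h0
  obtain ⟨f, u, hu, hu0⟩ := geometric_hahn_banach_closed_point hconv.closure isClosed_closure h0
  obtain ⟨x, hx⟩ := exists_dotProduct_eq (f : (ι → ℝ) →ₗ[ℝ] ℝ)
  have h1 : supportFun K x ≤ u := supportFun_le hne fun k hk => by
    rw [← hx]; exact (hu k (subset_closure hk)).le
  rw [map_zero] at hu0
  linarith [h x]

theorem zero_mem_interior_of_supportFun_pos (hne : K.Nonempty)
    (hconv : Convex ℝ K) (h : ∀ x, x ≠ 0 → 0 < supportFun K x) :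
    (0 : ι → ℝ) ∈ interior K := by
  by_cases hint : (interior K).Nonempty
  -- With nonempty interior, a functional negative on the interior is nonpositive on all of `K` by
  -- density, and its normal contradicts `h`.
  · by_contra h0
    obtain ⟨f, hf⟩ := geometric_hahn_banach_open_point hconv.interior isOpen_interior h0
    rw [map_zero] at hf
    obtain ⟨x, hx⟩ := exists_dotProduct_eq (f : (ι → ℝ) →ₗ[ℝ] ℝ)
    have hle : ∀ k ∈ closure (interior K), f k ≤ 0 := fun k hk =>
      closure_minimal (fun k hk => (hf k hk).le) (isClosed_le f.continuous continuous_const) hk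
    have hσ : supportFun K x ≤ 0 := supportFun_le hne fun k hk => by
      rw [← hx]
      apply hle
      rw [hconv.closure_interior_eq_closure_of_nonempty_interior hint]
      exact subset_closure hk
    have hx0 : x ≠ 0 := by
      rintro rfl
      obtain ⟨k, hk⟩ := hint
      have h1 := hf k hk
      have h2 : f k = (0 : ι → ℝ) ⬝ᵥ k := hx k
      rw [zero_dotProduct] at h2
      exact absurd h2 h1.ne
    exact absurd (h x hx0) hσ.not_gt
  -- With empty interior, `K` lies in a proper affine subspace. A nonzero normal `x` is constant on
  -- `K`, so `σ(x) + σ(-x) ≤ 0`, although both terms should be positive.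
  · exfalso
    rw [hconv.interior_nonempty_iff_affineSpan_eq_top] at hint
    obtain ⟨k₀, hk₀⟩ := hne
    have hspan : ((affineSpan ℝ K : AffineSubspace ℝ (ι → ℝ)) : Set (ι → ℝ)).Nonempty :=
      ⟨k₀, subset_affineSpan ℝ K hk₀⟩
    have hdir : (affineSpan ℝ K).direction ≠ ⊤ := fun h' =>
      hint ((AffineSubspace.direction_eq_top_iff_of_nonempty hspan).1 h')
    obtain ⟨f, hf0, hf⟩ := Submodule.exists_dual_map_eq_bot_of_lt_top hdir.lt_top inferInstance
    obtain ⟨x, hx⟩ := exists_dotProduct_eq f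
    have hconst : ∀ k ∈ K, x ⬝ᵥ k = x ⬝ᵥ k₀ := fun k hk => by
      have hm : k - k₀ ∈ (affineSpan ℝ K).direction :=
        AffineSubspace.vsub_mem_direction (subset_affineSpan ℝ K hk) (subset_affineSpan ℝ K hk₀)
      have : f (k - k₀) ∈ Submodule.map f (affineSpan ℝ K).direction :=
        Submodule.mem_map_of_mem hm
      rw [hf, Submodule.mem_bot, map_sub, hx, hx] at this
      linarith
    have hx0 : x ≠ 0 := by
      rintro rfl
      exact hf0 (LinearMap.ext fun k => by simp [hx])
    have h1 := h x hx0
    have h2 := h (-x) (neg_ne_zero.2 hx0)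
    have h3 : supportFun K x ≤ x ⬝ᵥ k₀ := supportFun_le ⟨k₀, hk₀⟩ fun k hk => (hconst k hk).le
    have h4 : supportFun K (-x) ≤ -(x ⬝ᵥ k₀) := supportFun_le ⟨k₀, hk₀⟩ fun k hk => by
      rw [neg_dotProduct, hconst k hk]
    linarith

theorem exists_pos_smul_mem_of_supportFun_pos (hne : K.Nonempty)
    (hconv : Convex ℝ K) (h : ∀ x, x ≠ 0 → 0 < supportFun K x) (v : ι → ℝ) :
    ∃ t : ℝ, 0 < t ∧ t • v ∈ K := by
  have h0 : (0 : ι → ℝ) ∈ interior K := zero_mem_interior_of_supportFun_pos hne hconv h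
  have hcont : Tendsto (fun t : ℝ => t • v) (𝓝[>] 0) (𝓝 0) := by
    have : Tendsto (fun t : ℝ => t • v) (𝓝 0) (𝓝 ((0 : ℝ) • v)) :=
      (continuous_id.smul continuous_const).tendsto 0
    rw [zero_smul] at this
    exact this.mono_left nhdsWithin_le_nhds
  obtain ⟨t, ht, hpos⟩ :=
    ((hcont.eventually (mem_interior_iff_mem_nhds.1 h0)).and self_mem_nhdsWithin).exists
  exact ⟨t, hpos, ht⟩

variable {μ : ι → ℝ}

/-- The constant is the minimum of the continuous support function over the compact unit sphere of
`μ^⊥`; positive homogeneity extends the bound to all of `μ^⊥`. -/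
theorem exists_forall_mul_norm_le_supportFun (hK : Bornology.IsBounded K) (hne : K.Nonempty)
    (h : ∀ x, x ⬝ᵥ μ = 0 → x ≠ 0 → 0 < supportFun K x) :
    ∃ c : ℝ, 0 < c ∧ ∀ x, x ⬝ᵥ μ = 0 → c * ‖x‖ ≤ supportFun K x := by
  have hclosed : IsClosed {x : ι → ℝ | x ⬝ᵥ μ = 0} := by
    simp only [dotProduct_comm _ μ]
    exact isClosed_eq (continuous_dotProduct_right μ) continuous_const
  have hcomp : IsCompact (Metric.sphere (0 : ι → ℝ) 1 ∩ {x | x ⬝ᵥ μ = 0}) :=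
    (isCompact_sphere 0 1).inter_right hclosed
  rcases (Metric.sphere (0 : ι → ℝ) 1 ∩ {x | x ⬝ᵥ μ = 0}).eq_empty_or_nonempty with he | hn
  -- An empty unit sphere means `μ^⊥ = {0}`, so any constant works.
  · refine ⟨1, one_pos, fun x hx => ?_⟩
    suffices x = 0 by simp [this, supportFun_zero]
    by_contra hx0
    have : ‖x‖⁻¹ • x ∈ Metric.sphere (0 : ι → ℝ) 1 ∩ {x | x ⬝ᵥ μ = 0} := by
      refine ⟨by simp [norm_smul, hx0], ?_⟩
      simp only [mem_ofPred_eq] at hx ⊢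
      simp [hx]
    rw [he] at this
    exact this
  · obtain ⟨z, ⟨hz1, hz0⟩, hz⟩ :=
      hcomp.exists_isMinOn hn (continuous_supportFun hK hne).continuousOn
    have hzne : z ≠ 0 := by
      rintro rfl
      simp at hz1
    refine ⟨supportFun K z, h z hz0 hzne, fun x hx => ?_⟩
    by_cases hx0 : x = 0
    · simp [hx0, supportFun_zero]
    have hxpos : 0 < ‖x‖ := norm_pos_iff.2 hx0
    have hmem : ‖x‖⁻¹ • x ∈ Metric.sphere (0 : ι → ℝ) 1 ∩ {x | x ⬝ᵥ μ = 0} := by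
      refine ⟨by simp [norm_smul, hx0], ?_⟩
      simp only [mem_ofPred_eq] at hx ⊢
      simp [hx]
    have := isMinOn_iff.1 hz _ hmem
    rw [supportFun_smul (inv_nonneg.2 hxpos.le), inv_mul_eq_div, le_div_iff₀ hxpos] at this
    exact this

/-- The minimizers of the support function on the hyperplane `x · μ = ν`. -/
theorem argmin_supportFun (hK : Bornology.IsBounded K) (hne : K.Nonempty) (hμ : μ ≠ 0)
    (h : ∀ x, x ⬝ᵥ μ = 0 → x ≠ 0 → 0 < supportFun K x) (ν : ℝ) {S : Set (ι → ℝ)}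
    (hS : ∀ x, x ∈ S ↔
      x ⬝ᵥ μ = ν ∧ ∀ y, y ⬝ᵥ μ = ν → supportFun K x ≤ supportFun K y) :
    S.Nonempty ∧ IsCompact S ∧ Convex ℝ S := by
  obtain ⟨c, hc, hcoer⟩ := exists_forall_mul_norm_le_supportFun hK hne h
  have hcont := continuous_supportFun hK hne
  have hclosed : IsClosed {x : ι → ℝ | x ⬝ᵥ μ = ν} := by
    simp only [dotProduct_comm _ μ]
    exact isClosed_eq (continuous_dotProduct_right μ) continuous_const
  have hμμ : μ ⬝ᵥ μ ≠ 0 := fun h0 => hμ (dotProduct_self_eq_zero.1 h0)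
  obtain ⟨x₀, hx₀⟩ : ∃ x₀ : ι → ℝ, x₀ ⬝ᵥ μ = ν :=
    ⟨(ν / (μ ⬝ᵥ μ)) • μ, by rw [smul_dotProduct, smul_eq_mul, div_mul_cancel₀ _ hμμ]⟩
  have hcompact : ∀ a : ℝ, IsCompact ({x : ι → ℝ | x ⬝ᵥ μ = ν} ∩ {x | supportFun K x ≤ a}) := by
    intro a
    refine (isCompact_closedBall x₀ ((a + supportFun K (-x₀)) / c)).of_isClosed_subset
      (hclosed.inter (isClosed_le hcont continuous_const)) ?_
    rintro x ⟨hx, hxa⟩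
    simp only [mem_ofPred_eq] at hx hxa
    rw [mem_closedBall_iff_norm, le_div_iff₀ hc, mul_comm]
    -- Coercivity holds on `μ^⊥`; subadditivity transfers it to the parallel hyperplane through
    -- `x₀`.
    have h1 := hcoer (x - x₀) (by rw [sub_dotProduct, hx, hx₀, sub_self])
    have h2 := supportFun_add_le hK hne x (-x₀)
    rw [← sub_eq_add_neg] at h2
    linarith
  obtain ⟨z, ⟨hzν, hzx₀⟩, hz⟩ :=
    (hcompact (supportFun K x₀)).exists_isMinOn ⟨x₀, hx₀, le_refl (supportFun K x₀)⟩ hcont.continuousOn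
  simp only [mem_ofPred_eq] at hzν hzx₀
  have hzmin : ∀ y, y ⬝ᵥ μ = ν → supportFun K z ≤ supportFun K y := fun y hy => by
    rcases le_total (supportFun K y) (supportFun K x₀) with hy' | hy'
    · exact isMinOn_iff.1 hz y ⟨hy, hy'⟩
    · exact hzx₀.trans hy'
  have hSeq : S = {x : ι → ℝ | x ⬝ᵥ μ = ν} ∩ {x | supportFun K x ≤ supportFun K z} := by
    ext x
    rw [hS]
    exact ⟨fun hx => ⟨hx.1, hx.2 z hzν⟩, fun hx => ⟨hx.1, fun y hy => hx.2.trans (hzmin y hy)⟩⟩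
  refine ⟨⟨z, (hS z).2 ⟨hzν, hzmin⟩⟩, hSeq ▸ hcompact _, ?_⟩
  rw [hSeq]
  refine Convex.inter (fun x hx y hy a b _ _ hab => ?_) ?_
  · simp only [mem_ofPred_eq] at hx hy ⊢
    rw [add_dotProduct, smul_dotProduct, smul_dotProduct, hx, hy, ← add_smul, hab, one_smul]
  · simpa using (convexOn_supportFun hK hne).convex_le (supportFun K z)

/-- Simultaneous strict improvement of `x · μ` and of the support function. -/
theorem forall_exists_lt_iff_exists_supportFun_neg (hK : Bornology.IsBounded K)
    (hμK : -μ ∈ K) :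
    (∀ x, ∃ y, x ⬝ᵥ μ < y ⬝ᵥ μ ∧ supportFun K y < supportFun K x) ↔
      ∃ x, supportFun K x < 0 := by
  constructor
  · intro h
    obtain ⟨y, -, hy⟩ := h 0
    exact ⟨y, by rwa [supportFun_zero] at hy⟩
  · rintro ⟨z, hz⟩ x
    -- Since `-μ ∈ K`, negative risk of `z` forces `z · μ > 0`, so adding `z` improves both
    -- criteria.
    have h1 := dotProduct_le_supportFun hK z hμK
    rw [dotProduct_neg] at h1
    refine ⟨x + z, ?_, ?_⟩
    · rw [add_dotProduct]
      linarith
    · linarith [supportFun_add_le hK ⟨_, hμK⟩ x z]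

/-- Existence of Pareto optimal points for `x · μ` and the support function. -/
theorem exists_pareto_iff_supportFun_pos (hK : Bornology.IsBounded K)
    (hμK : -μ ∈ K) (h : ∀ x, x ⬝ᵥ μ = 0 → x ≠ 0 → 0 < supportFun K x) :
    (∃ x, 0 ≤ x ⬝ᵥ μ ∧ ¬ ∃ y, x ⬝ᵥ μ ≤ y ⬝ᵥ μ ∧ supportFun K y ≤ supportFun K x ∧
      (x ⬝ᵥ μ < y ⬝ᵥ μ ∨ supportFun K y < supportFun K x)) ↔
      ∀ x, x ≠ 0 → 0 < supportFun K x := by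
  have hge : ∀ x, -(x ⬝ᵥ μ) ≤ supportFun K x := fun x => by
    have := dotProduct_le_supportFun hK x hμK
    rwa [dotProduct_neg] at this
  constructor
  · rintro ⟨x, -, hx⟩ z hz
    -- Only `z · μ > 0` is compatible with `σ(z) ≤ 0`, and then `x + z` would beat the Pareto
    -- optimal `x`.
    rcases lt_trichotomy (z ⬝ᵥ μ) 0 with h0 | h0 | h0
    · linarith [hge z]
    · exact h z h0 hz
    · by_contra hz0
      refine hx ⟨x + z, ?_, ?_, Or.inl ?_⟩
      · rw [add_dotProduct]; linarith
      · linarith [supportFun_add_le hK ⟨_, hμK⟩ x z]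
      · rw [add_dotProduct]; linarith
  · intro hpos
    refine ⟨0, by simp, ?_⟩
    rintro ⟨y, -, hy, hlt⟩
    rw [supportFun_zero] at hy hlt
    have hy0 : y = 0 := by
      by_contra hy0
      exact absurd (hpos y hy0) hy.not_gt
    simp [hy0, supportFun_zero] at hlt

end SupportFunction

/-! ### Expectations of convex functions of nonnegative random variables -/

section ConvexExpectation

variable {Ω : Type*} [MeasurableSpace Ω] {P : Measure Ω} {Φ g : ℝ → ℝ}

/-- A convex function on `[0, ∞)` is continuous on the open half-line but may jump at `0`, so the
value at `0` is treated separately. -/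
theorem aemeasurable_comp_of_convexOn {f : ℝ → ℝ} (hf : ConvexOn ℝ (Ici 0) f) {Z : Ω → ℝ}
    (hZ : AEMeasurable Z P) (hZ0 : ∀ᵐ ω ∂P, 0 ≤ Z ω) : AEMeasurable (fun ω => f (Z ω)) P := by
  classical
  have hcont : ContinuousOn f (Ioi 0) := by
    simpa using hf.continuousOn_interior
  have hmeas : Measurable ((Ioi (0 : ℝ)).piecewise f fun _ => f 0) :=
    hcont.measurable_piecewise continuousOn_const measurableSet_Ioi
  refine (hmeas.comp_aemeasurable hZ).congr ?_
  filter_upwards [hZ0] with ω hω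
  rcases hω.eq_or_lt with h | h
  · simp [← h]
  · simp [Set.piecewise, h]

theorem young_inequality (hdom : DominatesConjugate g Φ) {x y : ℝ} (hx : 0 ≤ x) (hy : 0 ≤ y) :
    x * y ≤ Φ x + g y := by
  have h : ((x * y - Φ x : ℝ) : EReal) ≤ (g y : EReal) :=
    le_trans (le_iSup₂_of_le (f := fun x (_ : x ∈ Ici (0 : ℝ)) => ((x * y - Φ x : ℝ) : EReal))
      x hx le_rfl) (hdom y hy)
  linarith [EReal.coe_le_coe_iff.1 h]

theorem nnExpectation_convexCombo_le (hg : ConvexOn ℝ (Ici 0) g) {Z W : Ω → ℝ}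
    (hZ : AEMeasurable Z P) (hZ0 : ∀ᵐ ω ∂P, 0 ≤ Z ω) (hW0 : ∀ᵐ ω ∂P, 0 ≤ W ω)
    {a b : ℝ} (ha : 0 ≤ a) (hb : 0 ≤ b) (hab : a + b = 1) :
    nnExpectation P g (a • Z + b • W) ≤
      ENNReal.ofReal a * nnExpectation P g Z + ENNReal.ofReal b * nnExpectation P g W := by
  unfold nnExpectation
  rw [← lintegral_const_mul' _ _ ENNReal.ofReal_ne_top,
    ← lintegral_const_mul' _ _ ENNReal.ofReal_ne_top, ← lintegral_add_left']
  · refine lintegral_mono_ae ?_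
    filter_upwards [hZ0, hW0] with ω h1 h2
    rw [← ENNReal.ofReal_mul ha, ← ENNReal.ofReal_mul hb]
    exact (ENNReal.ofReal_le_ofReal (hg.2 h1 h2 ha hb hab)).trans ENNReal.ofReal_add_le
  · exact ((aemeasurable_comp_of_convexOn hg hZ hZ0).ennreal_ofReal).const_mul _

theorem convex_densities : Convex ℝ (densities P) := by
  rintro Z ⟨hZ, hZ0, hZ1⟩ W ⟨hW, hW0, hW1⟩ a b ha hb hab
  refine ⟨(hZ.smul a).add (hW.smul b), ?_, ?_⟩
  · filter_upwards [hZ0, hW0] with ω h1 h2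
    simp only [Pi.add_apply, Pi.smul_apply, smul_eq_mul]
    positivity
  · simp only [Pi.add_apply, Pi.smul_apply, smul_eq_mul]
    rw [integral_add (hZ.const_mul a) (hW.const_mul b), integral_const_mul, integral_const_mul,
      hZ1, hW1]
    simpa using hab

theorem convex_entropicDualSet (hg : ConvexOn ℝ (Ici 0) g) {β : ℝ} :
    Convex ℝ (entropicDualSet P g β) := by
  rintro Z ⟨hZ, hZβ⟩ W ⟨hW, hWβ⟩ a b ha hb hab
  refine ⟨convex_densities hZ hW ha hb hab, ?_⟩
  refine (nnExpectation_convexCombo_le hg hZ.1.aemeasurable hZ.2.1 hW.2.1 ha hb hab).trans ?_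
  calc _ ≤ ENNReal.ofReal a * ENNReal.ofReal β + ENNReal.ofReal b * ENNReal.ofReal β := by gcongr
    _ = ENNReal.ofReal β := by
      rw [← add_mul, ← ENNReal.ofReal_add ha hb, hab, ENNReal.ofReal_one, one_mul]

theorem one_mem_densities [IsProbabilityMeasure P] : (1 : Ω → ℝ) ∈ densities P :=
  ⟨integrable_const 1, by simp, by simp⟩

theorem nnExpectation_one [IsProbabilityMeasure P] :
    nnExpectation P g 1 = ENNReal.ofReal (g 1) := by
  simp [nnExpectation]

/-- A density of finite `g`-entropy may be mixed slightly into one of `g`-entropy below `β`. -/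
theorem exists_mix_nnExpectation_lt (hg : ConvexOn ℝ (Ici 0) g) {β : ℝ} {Z W : Ω → ℝ}
    (hZ : Z ∈ densities P) (hW : W ∈ densities P)
    (hZβ : nnExpectation P g Z < ENNReal.ofReal β) (hWg : nnExpectation P g W < ⊤) :
    ∃ ε : ℝ, 0 < ε ∧ ε ≤ 1 ∧ nnExpectation P g ((1 - ε) • Z + ε • W) < ENNReal.ofReal β := by
  set p := nnExpectation P g Z
  set q := nnExpectation P g W
  have hlim : Tendsto (fun ε : ℝ => ENNReal.ofReal (1 - ε) * p + ENNReal.ofReal ε * q)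
      (𝓝[>] 0) (𝓝 p) := by
    have h1 : Tendsto (fun ε : ℝ => ENNReal.ofReal (1 - ε)) (𝓝[>] 0) (𝓝 (ENNReal.ofReal (1 - 0))) :=
      (ENNReal.continuous_ofReal.comp (continuous_const.sub continuous_id)).continuousWithinAt
    have h2 : Tendsto (fun ε : ℝ => ENNReal.ofReal ε) (𝓝[>] 0) (𝓝 (ENNReal.ofReal 0)) :=
      ENNReal.continuous_ofReal.continuousWithinAt
    have h3 := (ENNReal.Tendsto.mul_const (b := p) h1 (Or.inr (hZβ.trans_le le_top).ne)).add
      (ENNReal.Tendsto.mul_const (b := q) h2 (Or.inr hWg.ne))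
    simpa using h3
  have hmem : ∀ᶠ ε : ℝ in 𝓝[>] 0, ε ∈ Ioc (0 : ℝ) 1 := Ioc_mem_nhdsGT one_pos
  obtain ⟨ε, hε, hpos, hle⟩ := ((hlim.eventually (gt_mem_nhds hZβ)).and hmem).exists
  exact ⟨ε, hpos, hle, (nnExpectation_convexCombo_le hg hZ.1.aemeasurable hZ.2.1 hW.2.1
    (by linarith) hpos.le (by ring)).trans_lt hε⟩

/-- Young's inequality in expectation. -/
theorem ofReal_mul_lintegral_abs_mul_le (hΦ : ConvexOn ℝ (Ici 0) Φ)
    (hdom : DominatesConjugate g Φ) {Z R : Ω → ℝ} (hR : AEMeasurable R P)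
    (hZ0 : ∀ᵐ ω ∂P, 0 ≤ Z ω) {c : ℝ} (hc : 0 ≤ c) :
    ENNReal.ofReal c * ∫⁻ ω, ‖Z ω * R ω‖ₑ ∂P ≤
      nnExpectation P Φ (fun ω => c * |R ω|) + nnExpectation P g Z := by
  unfold nnExpectation
  rw [← lintegral_const_mul' _ _ ENNReal.ofReal_ne_top, ← lintegral_add_left']
  · refine lintegral_mono_ae ?_
    filter_upwards [hZ0] with ω h
    rw [← ofReal_norm, ← ENNReal.ofReal_mul hc, Real.norm_eq_abs, abs_mul,
      abs_of_nonneg h]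
    refine (ENNReal.ofReal_le_ofReal ?_).trans ENNReal.ofReal_add_le
    have := young_inequality hdom (mul_nonneg hc (abs_nonneg (R ω))) h
    linarith
  · exact (aemeasurable_comp_of_convexOn hΦ (hR.abs.const_mul c)
      (ae_of_all _ fun ω => by positivity)).ennreal_ofReal

theorem integrable_mul_of_memOrlicz (hΦ : ConvexOn ℝ (Ici 0) Φ)
    (hdom : DominatesConjugate g Φ) {Z R : Ω → ℝ} (hR : MemOrlicz P Φ R)
    (hZ : AEMeasurable Z P) (hZ0 : ∀ᵐ ω ∂P, 0 ≤ Z ω) (hZg : nnExpectation P g Z < ⊤) :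
    Integrable (fun ω => Z ω * R ω) P := by
  obtain ⟨hRm, c, hc, hcR⟩ := hR
  refine ⟨(hZ.mul hRm).aestronglyMeasurable, ?_⟩
  have h := (ofReal_mul_lintegral_abs_mul_le hΦ hdom hRm hZ0 hc.le).trans_lt
    (ENNReal.add_lt_top.2 ⟨hcR, hZg⟩)
  exact ENNReal.lt_top_of_mul_ne_top_right h.ne (ENNReal.ofReal_pos.2 hc).ne'

/-- Young's inequality with one fixed `c` bounds the expectation using only `E[Φ(c|R|)]` and `β`.
This uniformity in `Z` makes the loss set bounded. -/
theorem exists_bound_integral_mul (hΦ : ConvexOn ℝ (Ici 0) Φ)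
    (hdom : DominatesConjugate g Φ) {R : Ω → ℝ} (hR : MemOrlicz P Φ R) (β : ℝ) :
    ∃ C : ℝ, ∀ Z ∈ entropicDualSet P g β, |∫ ω, Z ω * R ω ∂P| ≤ C := by
  obtain ⟨hRm, c, hc, hcR⟩ := hR
  refine ⟨((nnExpectation P Φ (fun ω => c * |R ω|) + ENNReal.ofReal β) /
    ENNReal.ofReal c).toReal, fun Z hZ => ?_⟩
  have hc' : ENNReal.ofReal c ≠ 0 := (ENNReal.ofReal_pos.2 hc).ne'
  have h := (ofReal_mul_lintegral_abs_mul_le hΦ hdom hRm hZ.1.2.1 hc.le).trans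
    (add_le_add_right hZ.2 _)
  rw [mul_comm, ← ENNReal.le_div_iff_mul_le (Or.inl hc') (Or.inl ENNReal.ofReal_ne_top)] at h
  have h2 := (enorm_integral_le_lintegral_enorm (μ := P) fun ω => Z ω * R ω).trans h
  rw [← Real.norm_eq_abs, ← toReal_enorm]
  exact ENNReal.toReal_mono (ENNReal.div_lt_top
    (ENNReal.add_lt_top.2 ⟨hcR, ENNReal.ofReal_lt_top⟩).ne hc').ne h2

theorem extExpectation_eq_integral {Y : Ω → ℝ} (hY : Integrable Y P) :
    extExpectation P Y = ((∫ ω, Y ω ∂P : ℝ) : EReal) := by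
  have h1 : ∫⁻ ω, ENNReal.ofReal (Y ω) ∂P ≠ ⊤ := hY.lintegral_lt_top.ne
  have h2 : ∫⁻ ω, ENNReal.ofReal (-Y ω) ∂P ≠ ⊤ := hY.neg.lintegral_lt_top.ne
  rw [extExpectation, if_neg h1, integral_eq_lintegral_pos_part_sub_lintegral_neg_part hY,
    EReal.coe_sub, EReal.coe_ennreal_toReal h1, EReal.coe_ennreal_toReal h2]

end ConvexExpectation

/-! ### Entropic risk of portfolios as a support function -/

namespace Market

variable {Ω : Type*} [MeasurableSpace Ω] {d : ℕ}

/-- The vector `-E[Z (R - r)]` of expected losses under the density `Z`. -/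
noncomputable def expectedLoss (m : Market Ω d) (P : Measure Ω) (Z : Ω → ℝ) : Fin d → ℝ :=
  fun i => -∫ ω, Z ω * (m.ret i ω - m.r) ∂P

/-- The vector `E[R - r]` of expected excess returns. -/
noncomputable def meanExcess (m : Market Ω d) (P : Measure Ω) : Fin d → ℝ :=
  fun i => ∫ ω, (m.ret i ω - m.r) ∂P

theorem measurable_ret (m : Market Ω d) (i : Fin d) : Measurable (m.ret i) :=
  ((m.measurable_S₁ i).sub_const _).div_const _

theorem excessReturn_eq (m : Market Ω d) (π : Fin d → ℝ) (ω : Ω) :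
    m.excessReturn π ω = ∑ i, π i * (m.ret i ω - m.r) := by
  simp only [excessReturn, portfolioReturn, mul_sub, Finset.sum_sub_distrib, ← Finset.sum_mul]
  ring

theorem measurable_excessReturn (m : Market Ω d) (π : Fin d → ℝ) :
    Measurable (m.excessReturn π) := by
  have : m.excessReturn π = fun ω => ∑ i, π i * (m.ret i ω - m.r) :=
    funext (m.excessReturn_eq π)
  rw [this]
  exact Finset.measurable_sum _ fun i _ => ((m.measurable_ret i).sub_const _).const_mul _

/-- Wealth fractions are converted to numbers of shares, `π i / S₀ i`, financed by `-∑ π i` in the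
riskless asset. -/
theorem Nonredundant.eq_zero {m : Market Ω d} {P : Measure Ω} (h : m.Nonredundant P)
    {π : Fin d → ℝ} (hπ : ∀ᵐ ω ∂P, m.excessReturn π ω = 0) : π = 0 := by
  have hS : ∀ i, m.S₀ i ≠ 0 := fun i => (m.S₀_pos i).ne'
  have h0 : (-∑ i, π i) * 1 + ∑ i, (π i / m.S₀ i) * m.S₀ i = 0 := by
    simp [div_mul_cancel₀ _ (hS _)]
  have h1 : ∀ᵐ ω ∂P, (-∑ i, π i) * (1 + m.r) + ∑ i, (π i / m.S₀ i) * m.S₁ i ω = 0 := by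
    filter_upwards [hπ] with ω hω
    rw [excessReturn_eq] at hω
    rw [← hω, neg_mul, Finset.sum_mul, ← Finset.sum_neg_distrib, ← Finset.sum_add_distrib]
    refine Finset.sum_congr rfl fun i _ => ?_
    rw [ret]
    field_simp [hS i]
    ring
  have h2 := (h _ _ h0 h1).2
  funext i
  have := congrFun h2 i
  simpa [hS i] using this

section Density

variable {m : Market Ω d} {P : Measure Ω} {Z : Ω → ℝ}

theorem integrable_mul_excess (hZ : Integrable Z P)
    (hZR : ∀ i, Integrable (fun ω => Z ω * m.ret i ω) P) (i : Fin d) :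
    Integrable (fun ω => Z ω * (m.ret i ω - m.r)) P := by
  simp only [mul_sub]
  exact (hZR i).sub (hZ.mul_const _)

theorem integrable_mul_excessReturn (hZ : Integrable Z P)
    (hZR : ∀ i, Integrable (fun ω => Z ω * m.ret i ω) P) (π : Fin d → ℝ) :
    Integrable (fun ω => Z ω * m.excessReturn π ω) P := by
  simp only [excessReturn_eq, Finset.mul_sum, mul_left_comm (Z _) (π _)]
  exact integrable_finsetSum _ fun i _ => (integrable_mul_excess hZ hZR i).const_mul _

theorem dotProduct_expectedLoss (hZ : Integrable Z P)
    (hZR : ∀ i, Integrable (fun ω => Z ω * m.ret i ω) P) (π : Fin d → ℝ) :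
    π ⬝ᵥ m.expectedLoss P Z = -∫ ω, Z ω * m.excessReturn π ω ∂P := by
  simp only [excessReturn_eq, Finset.mul_sum, mul_left_comm (Z _) (π _)]
  rw [integral_finsetSum _ fun i _ => (integrable_mul_excess hZ hZR i).const_mul _]
  simp only [integral_const_mul, dotProduct, expectedLoss, mul_neg, Finset.sum_neg_distrib]

theorem expectedLoss_convexCombo {W : Ω → ℝ} (hZ : Integrable Z P)
    (hZR : ∀ i, Integrable (fun ω => Z ω * m.ret i ω) P) (hW : Integrable W P)
    (hWR : ∀ i, Integrable (fun ω => W ω * m.ret i ω) P) (a b : ℝ) :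
    m.expectedLoss P (a • Z + b • W) = a • m.expectedLoss P Z + b • m.expectedLoss P W := by
  funext i
  simp only [expectedLoss, Pi.add_apply, Pi.smul_apply, smul_eq_mul, add_mul, mul_assoc]
  rw [integral_add ((integrable_mul_excess hZ hZR i).const_mul a)
    ((integrable_mul_excess hW hWR i).const_mul b), integral_const_mul, integral_const_mul]
  ring

theorem expectedLoss_one : m.expectedLoss P 1 = -m.meanExcess P := by
  funext i
  simp [expectedLoss, meanExcess]

end Density

end Market

/-- The standing assumptions on the market, the Young function and the entropy function. -/
structure EntropicModel {Ω : Type*} [MeasurableSpace Ω] {d : ℕ} (m : Market Ω d) (P : Measure Ω)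
    (Φ g : ℝ → ℝ) (β : ℝ) : Prop where
  nonredundant : m.Nonredundant P
  nondegenerate : m.Nondegenerate P
  convexOn_young : ConvexOn ℝ (Ici 0) Φ
  convexOn_entropy : ConvexOn ℝ (Ici 0) g
  entropy_nonneg : ∀ y, 0 ≤ y → 0 ≤ g y
  dominates : DominatesConjugate g Φ
  entropy_one_lt : g 1 < β
  memOrlicz_ret : ∀ i, MemOrlicz P Φ (m.ret i)

/-! ### The loss set and its support function -/

namespace EntropicModel

variable {Ω : Type*} [MeasurableSpace Ω] {P : Measure Ω} {d : ℕ}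
  {m : Market Ω d} {Φ g : ℝ → ℝ} {β : ℝ}

theorem nnExpectation_one_lt [IsProbabilityMeasure P] (H : EntropicModel m P Φ g β) :
    nnExpectation P g 1 < ENNReal.ofReal β := by
  rw [nnExpectation_one]
  exact (ENNReal.ofReal_lt_ofReal_iff
    ((H.entropy_nonneg 1 zero_le_one).trans_lt H.entropy_one_lt)).2 H.entropy_one_lt

theorem one_mem [IsProbabilityMeasure P] (H : EntropicModel m P Φ g β) : (1 : Ω → ℝ) ∈ entropicDualSet P g β :=
  ⟨one_mem_densities, H.nnExpectation_one_lt.le⟩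

theorem integrable_mul_ret (H : EntropicModel m P Φ g β) {Z : Ω → ℝ} (hZ : Z ∈ densities P)
    (hZg : nnExpectation P g Z < ⊤) (i : Fin d) : Integrable (fun ω => Z ω * m.ret i ω) P :=
  integrable_mul_of_memOrlicz H.convexOn_young H.dominates (H.memOrlicz_ret i)
    hZ.1.aemeasurable hZ.2.1 hZg

theorem integrable_mul_ret_of_mem (H : EntropicModel m P Φ g β) {Z : Ω → ℝ}
    (hZ : Z ∈ entropicDualSet P g β) (i : Fin d) : Integrable (fun ω => Z ω * m.ret i ω) P :=
  H.integrable_mul_ret hZ.1 (hZ.2.trans_lt ENNReal.ofReal_lt_top) i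

theorem integrable_ret [IsProbabilityMeasure P] (H : EntropicModel m P Φ g β) (i : Fin d) : Integrable (m.ret i) P := by
  simpa using H.integrable_mul_ret_of_mem H.one_mem i

theorem expectedExcess_eq [IsProbabilityMeasure P] (H : EntropicModel m P Φ g β) (π : Fin d → ℝ) :
    m.expectedExcess P π = π ⬝ᵥ m.meanExcess P := by
  have h := Market.dotProduct_expectedLoss H.one_mem.1.1 (H.integrable_mul_ret_of_mem H.one_mem) π
  rw [Market.expectedLoss_one, dotProduct_neg, neg_inj] at h
  rw [h]
  simp [Market.expectedExcess]

theorem meanExcess_ne_zero [IsProbabilityMeasure P] (H : EntropicModel m P Φ g β) : m.meanExcess P ≠ 0 := by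
  obtain ⟨i, hi⟩ := H.nondegenerate
  intro h
  have := congrFun h i
  simp only [Market.meanExcess, Pi.zero_apply] at this
  rw [integral_sub (H.integrable_ret i) (integrable_const _)] at this
  simp only [integral_const, probReal_univ, one_smul] at this
  exact hi (by linarith)

theorem expectedLoss_eq_zero_of_mem {Z : Ω → ℝ} (hZ : Z ∈ m.martingaleDensities P) :
    m.expectedLoss P Z = 0 := by
  funext i
  simp [Market.expectedLoss, (hZ.2 i).2]

theorem mem_martingaleDensities (H : EntropicModel m P Φ g β) {Z : Ω → ℝ} (hZ : Z ∈ densities P)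
    (hZg : nnExpectation P g Z < ⊤) (h0 : m.expectedLoss P Z = 0) :
    Z ∈ m.martingaleDensities P :=
  ⟨hZ, fun i => ⟨Market.integrable_mul_excess hZ.1 (H.integrable_mul_ret hZ hZg) i,
    neg_eq_zero.1 (congrFun h0 i)⟩⟩

/-- The set of the vectors `-E[Z (R - r)]`, for `Z ∈ 𝒬^{g,β}`. -/
noncomputable def lossSet (m : Market Ω d) (P : Measure Ω)
    (g : ℝ → ℝ) (β : ℝ) : Set (Fin d → ℝ) :=
  m.expectedLoss P '' entropicDualSet P g β

theorem neg_meanExcess_mem [IsProbabilityMeasure P] (H : EntropicModel m P Φ g β) : -m.meanExcess P ∈ lossSet m P g β :=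
  ⟨1, H.one_mem, Market.expectedLoss_one⟩

theorem convex_lossSet (H : EntropicModel m P Φ g β) : Convex ℝ (lossSet m P g β) := by
  rintro _ ⟨Z, hZ, rfl⟩ _ ⟨W, hW, rfl⟩ a b ha hb hab
  exact ⟨a • Z + b • W, convex_entropicDualSet H.convexOn_entropy hZ hW ha hb hab,
    Market.expectedLoss_convexCombo hZ.1.1 (H.integrable_mul_ret_of_mem hZ) hW.1.1
      (H.integrable_mul_ret_of_mem hW) a b⟩

theorem isBounded_lossSet (H : EntropicModel m P Φ g β) :
    Bornology.IsBounded (lossSet m P g β) := by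
  choose C hC using fun i => exists_bound_integral_mul (g := g) H.convexOn_young H.dominates
    (H.memOrlicz_ret i) β
  rw [← Bornology.forall_isBounded_image_eval_iff]
  intro i
  rw [isBounded_iff_forall_norm_le]
  refine ⟨C i + |m.r|, ?_⟩
  rintro _ ⟨_, ⟨Z, hZ, rfl⟩, rfl⟩
  simp only [Function.eval, Market.expectedLoss, norm_neg, mul_sub, Real.norm_eq_abs]
  rw [integral_sub (H.integrable_mul_ret_of_mem hZ i) (hZ.1.1.mul_const _), integral_mul_const,
    hZ.1.2.2, one_mul]
  exact (abs_sub _ _).trans (add_le_add_left (hC i Z hZ) _)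

/-- Every `Z X_π` is integrable, so the extended expectations are real and linear in `π`;
boundedness of the loss set makes their supremum real too. -/
theorem entropicRisk_eq [IsProbabilityMeasure P] (H : EntropicModel m P Φ g β) (π : Fin d → ℝ) :
    entropicRisk P g β (m.excessReturn π) = (supportFun (lossSet m P g β) π : EReal) := by
  have hval : ∀ Z ∈ entropicDualSet P g β,
      extExpectation P (fun ω => -(Z ω * m.excessReturn π ω)) =
        ((π ⬝ᵥ m.expectedLoss P Z : ℝ) : EReal) := fun Z hZ => by
    have hint := (Market.integrable_mul_excessReturn hZ.1.1 (H.integrable_mul_ret_of_mem hZ) π).neg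
    rw [Pi.neg_def] at hint
    rw [extExpectation_eq_integral hint, integral_neg,
      Market.dotProduct_expectedLoss hZ.1.1 (H.integrable_mul_ret_of_mem hZ)]
  have hne : (lossSet m P g β).Nonempty := ⟨_, H.neg_meanExcess_mem⟩
  refine le_antisymm (iSup₂_le fun Z hZ => ?_) ?_
  · rw [hval Z hZ, EReal.coe_le_coe_iff]
    exact dotProduct_le_supportFun H.isBounded_lossSet π (mem_image_of_mem _ hZ)
  · refine le_of_forall_lt fun c hc => ?_
    have : ∃ Z ∈ entropicDualSet P g β, c < ((π ⬝ᵥ m.expectedLoss P Z : ℝ) : EReal) := by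
      by_contra! hcon
      induction c with
      | bot => exact absurd (hcon 1 H.one_mem) (EReal.bot_lt_coe _).not_ge
      | top => exact absurd hc not_top_lt
      | coe c =>
        refine absurd (EReal.coe_lt_coe_iff.1 hc) (not_lt.2 (supportFun_le hne ?_))
        rintro _ ⟨Z, hZ, rfl⟩
        exact EReal.coe_le_coe_iff.1 (hcon Z hZ)
    obtain ⟨Z, hZ, hlt⟩ := this
    rw [← hval Z hZ] at hlt
    exact hlt.trans_le (le_iSup₂_of_le (f := fun Z (_ : Z ∈ entropicDualSet P g β) =>
      extExpectation P (fun ω => -(Z ω * m.excessReturn π ω))) Z hZ le_rfl)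

end EntropicModel

/-! ### Perturbing strictly positive densities -/

section Perturbation

variable {Ω : Type*} [MeasurableSpace Ω] {P : Measure Ω}

/-- A nonzero random variable of mean zero under the strictly positive density `Z` is positive
on a non-null set on which `Z` is bounded. -/
theorem exists_measurableSet_pos_of_integral_mul_eq_zero {Z X : Ω → ℝ} (hZ : AEMeasurable Z P)
    (hZ0 : ∀ᵐ ω ∂P, 0 < Z ω) (hX : Measurable X) (hZX : Integrable (fun ω => Z ω * X ω) P)
    (h0 : ∫ ω, Z ω * X ω ∂P = 0) (hne : ¬ ∀ᵐ ω ∂P, X ω = 0) :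
    ∃ A, MeasurableSet A ∧ P A ≠ 0 ∧ (∀ ω ∈ A, 0 < X ω) ∧
      ∃ N : ℝ, ∀ᵐ ω ∂P, ω ∈ A → Z ω ≤ N := by
  by_contra! hcon
  apply hne
  -- The sets `{X > 0, Z ≤ n}` exhaust `{X > 0}`. If all were null, then `X ≤ 0` a.s., and `E[ZX] =
  -- 0` with `Z > 0` would give `X = 0`. A measurable version of `Z` keeps these sets measurable.
  have hnull : ∀ n : ℕ, P ({ω | 0 < X ω} ∩ {ω | hZ.mk Z ω ≤ n}) = 0 := by
    intro n
    by_contra hn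
    refine hcon _ ((measurableSet_lt measurable_const hX).inter
      (measurableSet_le hZ.measurable_mk measurable_const)) hn (fun ω hω => hω.1) n ?_
    filter_upwards [hZ.ae_eq_mk] with ω h hω
    rw [h] at hω
    exact hω.2.not_ge hω.1.2
  have hle : ∀ᵐ ω ∂P, X ω ≤ 0 := by
    have h : ∀ᵐ ω ∂P, ∀ n : ℕ, ω ∉ {ω | 0 < X ω} ∩ {ω | hZ.mk Z ω ≤ n} :=
      ae_all_iff.2 fun n => measure_eq_zero_iff_ae_notMem.1 (hnull n)
    filter_upwards [h] with ω hω
    by_contra! hpos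
    obtain ⟨n, hn⟩ := exists_nat_ge (hZ.mk Z ω)
    exact hω n ⟨hpos, hn⟩
  have hnonneg : 0 ≤ᵐ[P] fun ω => -(Z ω * X ω) := by
    filter_upwards [hZ0, hle] with ω h1 h2
    simpa using mul_nonpos_of_nonneg_of_nonpos h1.le h2
  have hint : ∫ ω, -(Z ω * X ω) ∂P = 0 := by rw [integral_neg, h0, neg_zero]
  have := (integral_eq_zero_iff_of_nonneg_ae hnonneg hZX.neg).1 hint
  filter_upwards [this, hZ0] with ω h1 h2
  simpa [h2.ne'] using h1

theorem setIntegral_pos_of_pos_on {f : Ω → ℝ} (hf : Integrable f P) {A : Set Ω}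
    (hA : MeasurableSet A) (hPA : P A ≠ 0) (hpos : ∀ᵐ ω ∂P, ω ∈ A → 0 < f ω) :
    0 < ∫ ω in A, f ω ∂P := by
  have hpos' : ∀ᵐ ω ∂P.restrict A, 0 < f ω := (ae_restrict_iff' hA).2 hpos
  rw [integral_pos_iff_support_of_nonneg_ae (hpos'.mono fun _ h => h.le) hf.integrableOn]
  have : P.restrict A (Function.support f) = P.restrict A univ :=
    measure_congr (by
      filter_upwards [hpos'] with ω h
      exact propext ⟨fun _ => trivial, fun _ => h.ne'⟩)
  rw [this, Measure.restrict_apply_univ]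
  exact pos_iff_ne_zero.2 hPA

/-- Perturbing a strictly positive martingale density of finite `g`-entropy so that a given
nonzero payoff gets negative expectation. -/
theorem exists_density_integral_mul_neg [IsProbabilityMeasure P] {g : ℝ → ℝ}
    (hg : ConvexOn ℝ (Ici 0) g) {Z X : Ω → ℝ} (hZ : Z ∈ densities P)
    (hZ0 : ∀ᵐ ω ∂P, 0 < Z ω) (hZg : nnExpectation P g Z < ⊤) (hX : Measurable X)
    (hZX : Integrable (fun ω => Z ω * X ω) P) (h0 : ∫ ω, Z ω * X ω ∂P = 0)
    (hne : ¬ ∀ᵐ ω ∂P, X ω = 0) :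
    ∃ W ∈ densities P, nnExpectation P g W < ⊤ ∧ ∫ ω, W ω * X ω ∂P < 0 := by
  obtain ⟨A, hA, hPA, hAX, NA, hNA⟩ :=
    exists_measurableSet_pos_of_integral_mul_eq_zero hZ.1.aemeasurable hZ0 hX hZX h0 hne
  obtain ⟨B, hB, hPB, hBX, NB, hNB⟩ :=
    exists_measurableSet_pos_of_integral_mul_eq_zero (X := fun ω => -X ω) hZ.1.aemeasurable hZ0
      hX.neg (by simpa using hZX.neg) (by simpa [integral_neg] using h0) (by simpa using hne)
  set a := ∫ ω in A, Z ω ∂P with ha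
  set b := ∫ ω in B, Z ω ∂P with hb
  have hle1 : ∀ C : Set Ω, ∫ ω in C, Z ω ∂P ≤ 1 := fun C =>
    (setIntegral_le_integral hZ.1 hZ.2.1).trans_eq hZ.2.2
  have ha1 : a ≤ 1 := hle1 A
  have hb1 : b ≤ 1 := hle1 B
  have ha0 : 0 < a := setIntegral_pos_of_pos_on hZ.1 hA hPA (hZ0.mono fun _ h _ => h)
  have hb0 : 0 < b := setIntegral_pos_of_pos_on hZ.1 hB hPB (hZ0.mono fun _ h _ => h)
  have hdisj : ∀ ω, ω ∈ A → ω ∉ B := fun ω h1 h2 => by linarith [hAX ω h1, hBX ω h2]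
  -- Mass moves from `A`, where `X > 0`, to `B`, where `X < 0`. The crossed weights remove and add
  -- the same mass `ab`, and `a, b ≤ 1` keep `W` nonnegative and at most `2Z`.
  set W : Ω → ℝ := fun ω => Z ω + (a * B.indicator Z ω - b * A.indicator Z ω) with hW
  have hWA : ∀ ω ∈ A, W ω = (1 - b) * Z ω := fun ω h => by
    simp only [hW, indicator_of_mem h, indicator_of_notMem (hdisj ω h)]
    ring
  have hWB : ∀ ω ∈ B, W ω = (1 + a) * Z ω := fun ω h => by
    simp only [hW, indicator_of_mem h, indicator_of_notMem fun h' => hdisj ω h' h]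
    ring
  have hWC : ∀ ω, ω ∉ A → ω ∉ B → W ω = Z ω := fun ω h h' => by
    simp [hW, h, h']
  have hZA := hZ.1.indicator hA
  have hZB := hZ.1.indicator hB
  have hW0 : ∀ᵐ ω ∂P, 0 ≤ W ω := by
    filter_upwards [hZ0] with ω h
    by_cases h1 : ω ∈ A
    · rw [hWA ω h1]; exact mul_nonneg (by linarith) h.le
    by_cases h2 : ω ∈ B
    · rw [hWB ω h2]; exact mul_nonneg (by linarith) h.le
    rw [hWC ω h1 h2]; exact h.le
  refine ⟨W, ⟨hZ.1.add ((hZB.const_mul a).sub (hZA.const_mul b)), hW0, ?_⟩, ?_, ?_⟩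
  · have h1 : ∫ ω, W ω ∂P = ∫ ω, Z ω ∂P + (∫ ω, a * B.indicator Z ω ∂P -
        ∫ ω, b * A.indicator Z ω ∂P) := by
      rw [← integral_sub (hZB.const_mul a) (hZA.const_mul b)]
      exact integral_add hZ.1 ((hZB.const_mul a).sub (hZA.const_mul b))
    rw [h1, integral_const_mul, integral_const_mul, integral_indicator hA, integral_indicator hB,
      hZ.2.2, ← ha, ← hb]
    ring
  -- `W` differs from `Z` only on `A ∪ B`, where it takes values in `[0, N]`; there convexity bounds
  -- `g` by its values at the endpoints.
  · set N := max (2 * NA) (2 * NB)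
    set C := max (g 0) (g N)
    have hbd : nnExpectation P g W ≤ nnExpectation P g Z + ENNReal.ofReal C := by
      have hC : ENNReal.ofReal C = ∫⁻ _, ENNReal.ofReal C ∂P := by simp
      unfold nnExpectation
      rw [hC, ← lintegral_add_right _ measurable_const]
      refine lintegral_mono_ae ?_
      filter_upwards [hZ0, hW0, hNA, hNB] with ω h hw hNA hNB
      have key : W ω ≤ N → ENNReal.ofReal (g (W ω)) ≤
          ENNReal.ofReal (g (Z ω)) + ENNReal.ofReal C := fun hWN =>
        (ENNReal.ofReal_le_ofReal (hg.le_max_of_mem_Icc self_mem_Ici (hw.trans hWN)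
          ⟨hw, hWN⟩)).trans le_add_self
      by_cases h1 : ω ∈ A
      · refine key ((hWA ω h1).trans_le ?_)
        refine le_trans ?_ (le_max_left _ _)
        have := hNA h1
        nlinarith
      by_cases h2 : ω ∈ B
      · refine key ((hWB ω h2).trans_le ?_)
        refine le_trans ?_ (le_max_right _ _)
        have := hNB h2
        nlinarith
      rw [hWC ω h1 h2]
      exact le_self_add
    exact hbd.trans_lt (ENNReal.add_lt_top.2 ⟨hZg, ENNReal.ofReal_lt_top⟩)
  · have hfun : (fun ω => W ω * X ω) = fun ω => Z ω * X ω +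
        (a * B.indicator (fun ω => Z ω * X ω) ω - b * A.indicator (fun ω => Z ω * X ω) ω) := by
      funext ω
      by_cases h1 : ω ∈ A <;> by_cases h2 : ω ∈ B <;> simp [hW, h1, h2] <;> ring
    have hIA := (hZX.indicator hA).const_mul b
    have hIB := (hZX.indicator hB).const_mul a
    have h1 : ∫ ω, W ω * X ω ∂P = ∫ ω, Z ω * X ω ∂P +
        (∫ ω, a * B.indicator (fun ω => Z ω * X ω) ω ∂P -
          ∫ ω, b * A.indicator (fun ω => Z ω * X ω) ω ∂P) := by
      rw [hfun, ← integral_sub hIB hIA]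
      exact integral_add hZX (hIB.sub hIA)
    rw [h1, integral_const_mul, integral_const_mul, integral_indicator hA, integral_indicator hB,
      h0]
    have hposA : 0 < ∫ ω in A, Z ω * X ω ∂P := setIntegral_pos_of_pos_on hZX hA hPA
      (hZ0.mono fun ω h hω => mul_pos h (hAX ω hω))
    have hposB : 0 < ∫ ω in B, -(Z ω * X ω) ∂P := setIntegral_pos_of_pos_on hZX.neg hB hPB
      (hZ0.mono fun ω h hω => by
        have := mul_pos h (hBX ω hω)
        rwa [mul_neg] at this)
    rw [integral_neg] at hposB
    nlinarith

end Perturbation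

/-! ### Optimal portfolios and absence of arbitrage -/

namespace EntropicModel

variable {Ω : Type*} [MeasurableSpace Ω] {P : Measure Ω} [IsProbabilityMeasure P] {d : ℕ}
  {m : Market Ω d} {Φ g : ℝ → ℝ} {β : ℝ}

/-- The strict entropy bound leaves room to mix in a density under which `X_π` has negative mean;
`Z` itself contributes zero. -/
theorem supportFun_pos (H : EntropicModel m P Φ g β) {Z : Ω → ℝ} (hZ : Z ∈ densities P)
    (hZ0 : ∀ᵐ ω ∂P, 0 < Z ω) (hZβ : nnExpectation P g Z < ENNReal.ofReal β) {π : Fin d → ℝ}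
    (hπ : π ≠ 0) (horth : π ⬝ᵥ m.expectedLoss P Z = 0) :
    0 < supportFun (lossSet m P g β) π := by
  have hZg : nnExpectation P g Z < ⊤ := hZβ.trans_le le_top
  have hZR := H.integrable_mul_ret hZ hZg
  have h0 := Market.dotProduct_expectedLoss hZ.1 hZR π
  rw [horth, zero_eq_neg] at h0
  obtain ⟨W, hW, hWg, hneg⟩ := exists_density_integral_mul_neg H.convexOn_entropy hZ hZ0 hZg
    (m.measurable_excessReturn π) (Market.integrable_mul_excessReturn hZ.1 hZR π) h0
    fun h => hπ (H.nonredundant.eq_zero h)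
  obtain ⟨ε, hε, hε1, hεβ⟩ := exists_mix_nnExpectation_lt H.convexOn_entropy hZ hW hZβ hWg
  have hWR := H.integrable_mul_ret hW hWg
  have hmem : m.expectedLoss P ((1 - ε) • Z + ε • W) ∈ lossSet m P g β :=
    ⟨_, ⟨convex_densities hZ hW (by linarith) hε.le (by ring), hεβ.le⟩, rfl⟩
  refine lt_of_lt_of_le ?_ (dotProduct_le_supportFun H.isBounded_lossSet π hmem)
  rw [Market.expectedLoss_convexCombo hZ.1 hZR hW.1 hWR, dotProduct_add, dotProduct_smul,
    dotProduct_smul, horth, Market.dotProduct_expectedLoss hW.1 hWR, smul_zero, zero_add,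
    smul_eq_mul]
  exact mul_pos hε (neg_pos.2 hneg)

theorem supportFun_pos_of_meanExcess (H : EntropicModel m P Φ g β) (π : Fin d → ℝ)
    (hπ : π ⬝ᵥ m.meanExcess P = 0) (hne : π ≠ 0) : 0 < supportFun (lossSet m P g β) π :=
  H.supportFun_pos one_mem_densities (by simp) H.nnExpectation_one_lt hne
    (by rw [Market.expectedLoss_one, dotProduct_neg, hπ, neg_zero])

theorem optimalPortfolios_nonempty_compact_convex (H : EntropicModel m P Φ g β) (ν : ℝ) :
    (m.optimalPortfolios P (entropicRisk P g β) ν).Nonempty ∧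
      IsCompact (m.optimalPortfolios P (entropicRisk P g β) ν) ∧
      Convex ℝ (m.optimalPortfolios P (entropicRisk P g β) ν) := by
  refine argmin_supportFun H.isBounded_lossSet ⟨_, H.neg_meanExcess_mem⟩ H.meanExcess_ne_zero
    H.supportFun_pos_of_meanExcess ν fun π => ?_
  simp only [Market.optimalPortfolios, Market.portfolios, mem_ofPred_eq, H.entropicRisk_eq,
    H.expectedExcess_eq, EReal.coe_le_coe_iff, EReal.coe_lt_top, true_and]

theorem strongRhoArbitrage_iff (H : EntropicModel m P Φ g β) :
    m.StrongRhoArbitrage P (entropicRisk P g β) ↔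
      ∃ π, supportFun (lossSet m P g β) π < 0 := by
  rw [← forall_exists_lt_iff_exists_supportFun_neg H.isBounded_lossSet H.neg_meanExcess_mem]
  simp only [Market.StrongRhoArbitrage, H.entropicRisk_eq, H.expectedExcess_eq,
    EReal.coe_lt_coe_iff]

theorem not_rhoArbitrage_iff_supportFun_pos (H : EntropicModel m P Φ g β) :
    ¬ m.RhoArbitrage P (entropicRisk P g β) ↔
      ∀ π, π ≠ 0 → 0 < supportFun (lossSet m P g β) π := by
  rw [← exists_pareto_iff_supportFun_pos H.isBounded_lossSet H.neg_meanExcess_mem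
    H.supportFun_pos_of_meanExcess]
  simp only [Market.RhoArbitrage, Market.Efficient, Market.StrictlyPreferred, H.entropicRisk_eq,
    H.expectedExcess_eq, EReal.coe_lt_coe_iff, EReal.coe_le_coe_iff, not_not]

theorem not_rhoArbitrage_iff (H : EntropicModel m P Φ g β) :
    ¬ m.RhoArbitrage P (entropicRisk P g β) ↔
      ∃ Z ∈ m.equivalentMartingaleDensities P, nnExpectation P g Z < ENNReal.ofReal β := by
  rw [H.not_rhoArbitrage_iff_supportFun_pos]
  constructor
  · intro h
    -- `Z` has loss `tμ` and the density `1` has loss `-μ`. The weights `a`, `b` solve `a t = b`, `a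
    -- + b = 1`, so the losses cancel. The share `b` of `1` gives strict positivity and, since `g 1
    -- < β`, entropy strictly below `β`.
    obtain ⟨t, ht, Z, hZ, hZt⟩ := exists_pos_smul_mem_of_supportFun_pos
      ⟨_, H.neg_meanExcess_mem⟩ H.convex_lossSet h (m.meanExcess P)
    set a := 1 / (1 + t) with ha
    set b := t / (1 + t) with hb
    have ha0 : 0 < a := by positivity
    have hb0 : 0 < b := by positivity
    have hab : a + b = 1 := by rw [ha, hb]; field_simp
    have hWd := convex_densities hZ.1 one_mem_densities ha0.le hb0.le hab
    have hWβ : nnExpectation P g (a • Z + b • (1 : Ω → ℝ)) < ENNReal.ofReal β := by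
      refine (nnExpectation_convexCombo_le H.convexOn_entropy hZ.1.1.aemeasurable hZ.1.2.1
        one_mem_densities.2.1 ha0.le hb0.le hab).trans_lt ?_
      calc _ < ENNReal.ofReal a * ENNReal.ofReal β + ENNReal.ofReal b * ENNReal.ofReal β := by
            refine ENNReal.add_lt_add_of_le_of_lt ?_ (mul_le_mul_right hZ.2 _) ?_
            · exact (ENNReal.mul_lt_top ENNReal.ofReal_lt_top
                (hZ.2.trans_lt ENNReal.ofReal_lt_top)).ne
            · exact (ENNReal.mul_lt_mul_iff_right (ENNReal.ofReal_pos.2 hb0).ne'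
                ENNReal.ofReal_ne_top).2 H.nnExpectation_one_lt
        _ = ENNReal.ofReal β := by
          rw [← add_mul, ← ENNReal.ofReal_add ha0.le hb0.le, hab, ENNReal.ofReal_one, one_mul]
    refine ⟨_, ⟨H.mem_martingaleDensities hWd (hWβ.trans_le le_top) ?_, ?_⟩, hWβ⟩
    · rw [Market.expectedLoss_convexCombo hZ.1.1 (H.integrable_mul_ret_of_mem hZ)
        one_mem_densities.1 (H.integrable_mul_ret_of_mem H.one_mem), hZt, Market.expectedLoss_one,
        smul_smul, smul_neg, ← sub_eq_add_neg, ← sub_smul]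
      have : a * t - b = 0 := by rw [ha, hb]; ring
      rw [this, zero_smul]
    · filter_upwards [hZ.1.2.1] with ω h
      simp only [Pi.add_apply, Pi.smul_apply, smul_eq_mul, Pi.one_apply]
      positivity
  · rintro ⟨Z, ⟨hZ, hZ0⟩, hZβ⟩ π hπ
    exact H.supportFun_pos hZ.1 hZ0 hZβ hπ
      (by rw [expectedLoss_eq_zero_of_mem hZ, dotProduct_zero])

end EntropicModel

/-! ### Almost sure selection and passage to the limit -/

section Compactness

variable {Ω : Type*} [MeasurableSpace Ω] {P : Measure Ω}

theorem integrable_exp_neg [IsProbabilityMeasure P] {Z : Ω → ℝ} (hZ : AEMeasurable Z P) (hZ0 : ∀ᵐ ω ∂P, 0 ≤ Z ω) :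
    Integrable (fun ω => Real.exp (-Z ω)) P := by
  refine Integrable.of_bound (hZ.neg.exp).aestronglyMeasurable 1 ?_
  filter_upwards [hZ0] with ω h
  rw [Real.norm_eq_abs, Real.abs_exp]
  exact Real.exp_le_one_iff.2 (neg_nonpos.2 h)

theorem memLp_exp_neg_half [IsProbabilityMeasure P] {Z : Ω → ℝ} (hZ : AEMeasurable Z P) (hZ0 : ∀ᵐ ω ∂P, 0 ≤ Z ω) :
    MemLp (fun ω => Real.exp (-Z ω / 2)) 2 P := by
  refine MemLp.of_bound ((hZ.neg.div_const 2).exp).aestronglyMeasurable 1 ?_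
  filter_upwards [hZ0] with ω h
  rw [Real.norm_eq_abs, Real.abs_exp]
  exact Real.exp_le_one_iff.2 (by linarith)

/-- This quantifies the strict convexity of `Z ↦ E[exp(-Z)]`: the convexity gap at the midpoint is
an `L²` distance. -/
theorem integral_sq_exp_neg_half_sub [IsProbabilityMeasure P] {Z W : Ω → ℝ} (hZ : AEMeasurable Z P)
    (hZ0 : ∀ᵐ ω ∂P, 0 ≤ Z ω) (hW : AEMeasurable W P) (hW0 : ∀ᵐ ω ∂P, 0 ≤ W ω) :
    ∫ ω, (Real.exp (-Z ω / 2) - Real.exp (-W ω / 2)) ^ 2 ∂P =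
      ∫ ω, Real.exp (-Z ω) ∂P + ∫ ω, Real.exp (-W ω) ∂P -
        2 * ∫ ω, Real.exp (-((1 / 2 : ℝ) • Z + (1 / 2 : ℝ) • W) ω) ∂P := by
  have hM0 : ∀ᵐ ω ∂P, 0 ≤ ((1 / 2 : ℝ) • Z + (1 / 2 : ℝ) • W) ω := by
    filter_upwards [hZ0, hW0] with ω h1 h2
    simp only [Pi.add_apply, Pi.smul_apply, smul_eq_mul]
    positivity
  have hM := integrable_exp_neg ((hZ.const_smul (1 / 2 : ℝ)).add (hW.const_smul (1 / 2 : ℝ))) hM0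
  have hZi := integrable_exp_neg hZ hZ0
  have hWi := integrable_exp_neg hW hW0
  have hadd : Integrable (fun ω => Real.exp (-Z ω) + Real.exp (-W ω)) P := hZi.add hWi
  rw [← integral_const_mul, ← integral_add hZi hWi, ← integral_sub hadd (hM.const_mul 2)]
  refine integral_congr_ae (ae_of_all _ fun ω => ?_)
  simp only [Pi.add_apply, Pi.smul_apply, smul_eq_mul]
  have h1 : Real.exp (-Z ω) = Real.exp (-Z ω / 2) * Real.exp (-Z ω / 2) := by
    rw [← Real.exp_add]; congr 1; ring
  have h2 : Real.exp (-W ω) = Real.exp (-W ω / 2) * Real.exp (-W ω / 2) := by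
    rw [← Real.exp_add]; congr 1; ring
  have h3 : Real.exp (-(1 / 2 * Z ω + 1 / 2 * W ω)) =
      Real.exp (-Z ω / 2) * Real.exp (-W ω / 2) := by
    rw [← Real.exp_add]; congr 1; ring
  rw [h1, h2, h3]
  ring

theorem norm_toLp_sub_sq {u v : Ω → ℝ} (hu : MemLp u 2 P) (hv : MemLp v 2 P) :
    ‖hu.toLp u - hv.toLp v‖ ^ 2 = ∫ ω, (u ω - v ω) ^ 2 ∂P := by
  rw [← hu.toLp_sub hv, ← real_inner_self_eq_norm_sq, L2.inner_def]
  refine integral_congr_ae ?_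
  filter_upwards [(hu.sub hv).coeFn_toLp] with ω h
  rw [h]
  simp [sq]

theorem aemeasurable_liminf {f : ℕ → Ω → ℝ≥0∞} (hf : ∀ n, AEMeasurable (f n) P) :
    AEMeasurable (fun ω => liminf (fun n => f n ω) atTop) P := by
  refine ⟨_, Measurable.liminf fun n => (hf n).measurable_mk, ?_⟩
  filter_upwards [ae_all_iff.2 fun n => (hf n).ae_eq_mk] with ω h
  simp only [h]

/-- A decreasing sequence of nonempty convex sets of densities admits a selection
that converges almost surely. -/
theorem exists_seq_tendsto_ae_of_convex [IsProbabilityMeasure P] {C : ℕ → Set (Ω → ℝ)} (hanti : Antitone C)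
    (hconv : ∀ n, Convex ℝ (C n)) (hne : ∀ n, (C n).Nonempty)
    (hC : ∀ n, C n ⊆ densities P) :
    ∃ (Zs : ℕ → Ω → ℝ) (Z : Ω → ℝ), (∀ n, Zs n ∈ C n) ∧
      ∀ᵐ ω ∂P, Tendsto (fun n => Zs n ω) atTop (𝓝 (Z ω)) := by
  set F : (Ω → ℝ) → ℝ := fun Z => ∫ ω, Real.exp (-Z ω) ∂P with hF
  have hF0 : ∀ Z, 0 ≤ F Z := fun Z => integral_nonneg fun ω => (Real.exp_pos _).le
  have hF1 : ∀ Z ∈ densities P, F Z ≤ 1 := fun Z hZ => by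
    have : F Z ≤ ∫ _, (1 : ℝ) ∂P := integral_mono_ae
      (integrable_exp_neg hZ.1.aemeasurable hZ.2.1) (integrable_const _) (by
        filter_upwards [hZ.2.1] with ω h
        exact Real.exp_le_one_iff.2 (neg_nonpos.2 h))
    simpa using this
  have hbdd : ∀ n, BddBelow (F '' C n) := fun n =>
    ⟨0, by rintro _ ⟨Z, -, rfl⟩; exact hF0 Z⟩
  set a : ℕ → ℝ := fun n => sInf (F '' C n) with ha
  have ha_mono : Monotone a := fun n k hnk =>
    csInf_le_csInf (hbdd n) ((hne k).image _) (image_mono (hanti hnk))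
  have ha_bdd : BddAbove (range a) := by
    refine ⟨1, ?_⟩
    rintro _ ⟨n, rfl⟩
    obtain ⟨Z, hZ⟩ := hne n
    exact (csInf_le (hbdd n) (mem_image_of_mem F hZ)).trans (hF1 Z (hC n hZ))
  have hex : ∀ n : ℕ, ∃ Z ∈ C n, F Z < a n + 1 / ((n : ℝ) + 1) := fun n => by
    obtain ⟨_, ⟨Z, hZ, rfl⟩, hlt⟩ := exists_lt_of_csInf_lt ((hne n).image F)
      (show a n < a n + 1 / ((n : ℝ) + 1) by linarith [Nat.one_div_pos_of_nat (α := ℝ) (n := n)])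
    exact ⟨Z, hZ, hlt⟩
  choose Y hYC hYF using hex
  have hYd : ∀ n, Y n ∈ densities P := fun n => hC n (hYC n)
  have hu : ∀ n, MemLp (fun ω => Real.exp (-Y n ω / 2)) 2 P := fun n =>
    memLp_exp_neg_half (hYd n).1.aemeasurable (hYd n).2.1
  -- Both `Y N` and `Y n` almost minimize `F` on their sets, while their midpoint lies in `C N` and
  -- has `F` at least `a N`. The gap identity then makes the sequence Cauchy, since `a` increases to
  -- a finite limit.
  have hdist : ∀ N n, N ≤ n → ‖(hu N).toLp _ - (hu n).toLp _‖ ^ 2 ≤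
      (⨆ i, a i) - a N + 2 * (1 / ((N : ℝ) + 1)) := fun N n hNn => by
    rw [norm_toLp_sub_sq, integral_sq_exp_neg_half_sub (hYd N).1.aemeasurable (hYd N).2.1
      (hYd n).1.aemeasurable (hYd n).2.1]
    have hmid : (1 / 2 : ℝ) • Y N + (1 / 2 : ℝ) • Y n ∈ C N :=
      hconv N (hYC N) (hanti hNn (hYC n)) (by norm_num) (by norm_num) (by norm_num)
    have h1 : a N ≤ F _ := csInf_le (hbdd N) (mem_image_of_mem F hmid)
    have h2 := hYF N
    have h3 := hYF n
    have h4 : a n ≤ ⨆ i, a i := le_ciSup ha_bdd n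
    have h5 : 1 / ((n : ℝ) + 1) ≤ 1 / ((N : ℝ) + 1) := Nat.one_div_le_one_div hNn
    simp only [hF] at h1 h2 h3
    linarith
  have hcauchy : CauchySeq fun n => (hu n).toLp _ := by
    refine cauchySeq_of_le_tendsto_0'
      (fun N => √((⨆ i, a i) - a N + 2 * (1 / ((N : ℝ) + 1)))) (fun N n hNn => ?_) ?_
    · rw [dist_eq_norm]
      exact Real.le_sqrt_of_sq_le (hdist N n hNn)
    · have h1 : Tendsto (fun N : ℕ => (⨆ i, a i) - a N + 2 * (1 / ((N : ℝ) + 1))) atTop (𝓝 0) := by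
        simpa using ((tendsto_atTop_ciSup ha_mono ha_bdd).const_sub (⨆ i, a i)).add
          (tendsto_one_div_add_atTop_nhds_zero_nat.const_mul (2 : ℝ))
      simpa using h1.sqrt
  obtain ⟨w, hw⟩ := cauchySeq_tendsto_of_complete hcauchy
  obtain ⟨φ, hφ, hae⟩ := (tendstoInMeasure_of_tendsto_Lp hw).exists_seq_tendsto_ae
  have hu_ae : ∀ᵐ ω ∂P, ∀ n, ((hu n).toLp _ : Ω → ℝ) ω = Real.exp (-Y n ω / 2) :=
    ae_all_iff.2 fun n => (hu n).coeFn_toLp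
  -- By Fatou, unit mass prevents the densities from tending to infinity on a non-null set. Hence
  -- the limit `w` of `exp(-Y/2)` is a.s. nonzero and the logarithm can be taken.
  have hfin : ∀ᵐ ω ∂P, liminf (fun n => ENNReal.ofReal (Y (φ n) ω)) atTop < ⊤ := by
    refine ae_lt_top' (aemeasurable_liminf fun n =>
      (hYd _).1.aemeasurable.ennreal_ofReal) (ne_top_of_le_ne_top ENNReal.one_ne_top ?_)
    refine (lintegral_liminf_le' fun n => (hYd _).1.aemeasurable.ennreal_ofReal).trans ?_
    have : ∀ n, ∫⁻ ω, ENNReal.ofReal (Y (φ n) ω) ∂P = 1 := fun n => by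
      rw [← ofReal_integral_eq_lintegral_ofReal (hYd _).1 (hYd _).2.1, (hYd _).2.2,
        ENNReal.ofReal_one]
    simp [this]
  refine ⟨fun n => Y (φ n), fun ω => -2 * Real.log (w ω),
    fun n => hanti (hφ.id_le n) (hYC _), ?_⟩
  filter_upwards [hae, hu_ae, hfin] with ω h1 h2 h3
  have h4 : Tendsto (fun n => Real.exp (-Y (φ n) ω / 2)) atTop (𝓝 (w ω)) := by
    simpa only [h2] using h1
  have hlog : ∀ n, Y (φ n) ω = -2 * Real.log (Real.exp (-Y (φ n) ω / 2)) := fun n => by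
    rw [Real.log_exp]; ring
  have hw0 : w ω ≠ 0 := fun hw0 => by
    rw [hw0] at h4
    have h5 : Tendsto (fun n => Real.exp (-Y (φ n) ω / 2)) atTop (𝓝[>] 0) :=
      tendsto_nhdsWithin_iff.2 ⟨h4, Eventually.of_forall fun n => Real.exp_pos _⟩
    have h6 : Tendsto (fun n => Y (φ n) ω) atTop atTop := by
      simp_rw +singlePass [hlog]
      exact (Real.tendsto_log_nhdsGT_zero.comp h5).const_mul_atBot_of_neg (by norm_num)
    exact h3.ne (ENNReal.tendsto_ofReal_atTop.comp h6).liminf_eq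
  have h5 := (h4.log hw0).const_mul (-2 : ℝ)
  simpa only [← hlog] using h5

variable {Φ g : ℝ → ℝ}

theorem memOrliczHeart_one [IsProbabilityMeasure P] : MemOrliczHeart P Φ 1 := by
  have h : ∀ c : ℝ, nnExpectation P Φ (fun ω => c * |(1 : Ω → ℝ) ω|) < ⊤ := fun c => by
    simp [nnExpectation]
  exact ⟨⟨aemeasurable_const, 1, one_pos, h 1⟩, fun c _ => h c⟩

/-- Densities of bounded `g`-entropy that converge almost surely converge weakly against the
Orlicz heart of `Φ`. -/
theorem tendsto_integral_mul_of_memOrliczHeart (hΦ : ConvexOn ℝ (Ici 0) Φ)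
    (hg : ConvexOn ℝ (Ici 0) g) (hdom : DominatesConjugate g Φ)
    {Zs : ℕ → Ω → ℝ} {Z R : Ω → ℝ} (hR : MemOrliczHeart P Φ R)
    (hZs : ∀ n, AEMeasurable (Zs n) P) (hZs0 : ∀ n, ∀ᵐ ω ∂P, 0 ≤ Zs n ω)
    (hZ : AEMeasurable Z P) (hZ0 : ∀ᵐ ω ∂P, 0 ≤ Z ω)
    (hlim : ∀ᵐ ω ∂P, Tendsto (fun n => Zs n ω) atTop (𝓝 (Z ω)))
    {b : ℝ≥0∞} (hb : b ≠ ⊤) (hZsb : ∀ n, nnExpectation P g (Zs n) ≤ b)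
    (hZb : nnExpectation P g Z ≤ b) :
    Tendsto (fun n => ∫ ω, Zs n ω * R ω ∂P) atTop (𝓝 (∫ ω, Z ω * R ω ∂P)) := by
  have hRm := hR.1.1
  refine tendsto_integral_of_L1 _
    (hZ.mul hRm).aestronglyMeasurable
    (Eventually.of_forall fun n => integrable_mul_of_memOrlicz hΦ hdom hR.1 (hZs n) (hZs0 n)
      ((hZsb n).trans_lt hb.lt_top)) ?_
  set D : ℕ → Ω → ℝ≥0∞ := fun n ω => ‖Zs n ω * R ω - Z ω * R ω‖ₑ with hD
  have hDm : ∀ n, AEMeasurable (D n) P := fun n =>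
    (((hZs n).mul hRm).sub (hZ.mul hRm)).enorm
  rw [ENNReal.tendsto_nhds_zero]
  intro ε hε
  -- Young's inequality at scale `k` dominates the difference by `B = 2kΦ(|R|/k)` plus `k(g(Zs n) +
  -- g(Z))`. A small `k` makes the entropy part at most `ε / 2`. The heart condition makes `B`
  -- integrable however large `1/k` is, so dominated convergence handles the part truncated at `B`.
  obtain ⟨k, hk0, hk⟩ : ∃ k : ℝ, 0 < k ∧ ENNReal.ofReal k * (b + b) ≤ ε / 2 := by
    have h1 : Tendsto (fun k : ℝ => ENNReal.ofReal k * (b + b)) (𝓝[>] 0) (𝓝 0) := by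
      have h2 : Tendsto (fun k : ℝ => ENNReal.ofReal k) (𝓝[>] 0) (𝓝 (ENNReal.ofReal 0)) :=
        ENNReal.continuous_ofReal.continuousWithinAt
      simpa using ENNReal.Tendsto.mul_const (b := b + b) h2
        (Or.inr (ENNReal.add_ne_top.2 ⟨hb, hb⟩))
    obtain ⟨k, hk, hk0⟩ := ((h1.eventually (ge_mem_nhds (ENNReal.half_pos hε.ne'))).and
      self_mem_nhdsWithin).exists
    exact ⟨k, hk0, hk⟩
  set B : Ω → ℝ≥0∞ := fun ω =>
    ENNReal.ofReal k * (2 * ENNReal.ofReal (Φ (k⁻¹ * |R ω|))) with hB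
  have hΦm : AEMeasurable (fun ω => ENNReal.ofReal (Φ (k⁻¹ * |R ω|))) P :=
    (aemeasurable_comp_of_convexOn hΦ (hRm.abs.const_mul k⁻¹)
      (ae_of_all _ fun ω => by positivity)).ennreal_ofReal
  have hBm : AEMeasurable B P := (hΦm.const_mul 2).const_mul _
  have hBfin : ∫⁻ ω, B ω ∂P ≠ ⊤ := by
    rw [lintegral_const_mul' _ _ ENNReal.ofReal_ne_top, lintegral_const_mul' _ _ (by simp)]
    exact ENNReal.mul_ne_top ENNReal.ofReal_ne_top
      (ENNReal.mul_ne_top (by simp) (hR.2 k⁻¹ (inv_pos.2 hk0)).ne)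
  have hsmall : Tendsto (fun n => ∫⁻ ω, min (D n ω) (B ω) ∂P) atTop (𝓝 0) := by
    rw [← lintegral_zero (μ := P)]
    refine tendsto_lintegral_of_dominated_convergence' B (fun n => (hDm n).min hBm)
      (fun n => ae_of_all _ fun ω => min_le_right _ _) hBfin ?_
    filter_upwards [hlim] with ω h
    have h1 : Tendsto (fun n => D n ω) atTop (𝓝 0) := by
      have := ((h.mul_const (R ω)).sub_const (Z ω * R ω)).enorm
      simpa using this
    simpa using h1.min (tendsto_const_nhds (x := B ω))
  have hbound : ∀ n, ∫⁻ ω, D n ω ∂P ≤ ∫⁻ ω, min (D n ω) (B ω) ∂P + ε / 2 := fun n => by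
    have hGn := (aemeasurable_comp_of_convexOn hg (hZs n) (hZs0 n)).ennreal_ofReal
    have hpt : ∀ᵐ ω ∂P, D n ω ≤ min (D n ω) (B ω) +
        ENNReal.ofReal k * (ENNReal.ofReal (g (Zs n ω)) + ENNReal.ofReal (g (Z ω))) := by
      filter_upwards [hZs0 n, hZ0] with ω h1 h2
      rcases le_total (D n ω) (B ω) with h | h
      · rw [min_eq_left h]
        exact le_self_add
      · rw [min_eq_right h, hB, ← mul_add]
        have hy1 := young_inequality hdom (Φ := Φ) (x := k⁻¹ * |R ω|) (by positivity) h1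
        have hy2 := young_inequality hdom (Φ := Φ) (x := k⁻¹ * |R ω|) (by positivity) h2
        have hreal : |Zs n ω * R ω - Z ω * R ω| ≤
            k * ((Φ (k⁻¹ * |R ω|) + Φ (k⁻¹ * |R ω|)) + (g (Zs n ω) + g (Z ω))) := by
          calc |Zs n ω * R ω - Z ω * R ω| ≤ |Zs n ω * R ω| + |Z ω * R ω| := abs_sub _ _
            _ = k * (k⁻¹ * |R ω| * Zs n ω + k⁻¹ * |R ω| * Z ω) := by
              rw [abs_mul, abs_mul, abs_of_nonneg h1, abs_of_nonneg h2]
              field_simp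
            _ ≤ _ := mul_le_mul_of_nonneg_left (by linarith) hk0.le
        rw [hD]
        simp only
        rw [← ofReal_norm, Real.norm_eq_abs, two_mul]
        refine (ENNReal.ofReal_le_ofReal hreal).trans ?_
        rw [ENNReal.ofReal_mul hk0.le]
        gcongr
        exact ENNReal.ofReal_add_le.trans
          (add_le_add ENNReal.ofReal_add_le ENNReal.ofReal_add_le)
    calc ∫⁻ ω, D n ω ∂P ≤ ∫⁻ ω, (min (D n ω) (B ω) +
          ENNReal.ofReal k * (ENNReal.ofReal (g (Zs n ω)) + ENNReal.ofReal (g (Z ω)))) ∂P :=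
          lintegral_mono_ae hpt
      _ = ∫⁻ ω, min (D n ω) (B ω) ∂P +
          ENNReal.ofReal k * (nnExpectation P g (Zs n) + nnExpectation P g Z) := by
        rw [lintegral_add_left' ((hDm n).min hBm), lintegral_const_mul' _ _ ENNReal.ofReal_ne_top,
          lintegral_add_left' hGn]
        rfl
      _ ≤ ∫⁻ ω, min (D n ω) (B ω) ∂P + ENNReal.ofReal k * (b + b) := by
        gcongr
        exact hZsb n
      _ ≤ _ := by gcongr
  filter_upwards [hsmall.eventually (ge_mem_nhds (ENNReal.half_pos hε.ne'))] with n hn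
  calc ∫⁻ ω, D n ω ∂P ≤ _ := hbound n
    _ ≤ ε / 2 + ε / 2 := by gcongr
    _ = ε := ENNReal.add_halves ε

/-- Fatou's lemma; continuity at `0` gives convergence of `g(Zs n)` also where the limit density
vanishes. -/
theorem nnExpectation_le_of_tendsto_ae (hg : ConvexOn ℝ (Ici 0) g)
    (hg0 : ContinuousWithinAt g (Ici 0) 0) {Zs : ℕ → Ω → ℝ} {Z : Ω → ℝ}
    (hZs : ∀ n, AEMeasurable (Zs n) P) (hZs0 : ∀ n, ∀ᵐ ω ∂P, 0 ≤ Zs n ω)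
    (hlim : ∀ᵐ ω ∂P, Tendsto (fun n => Zs n ω) atTop (𝓝 (Z ω)))
    {b : ℝ≥0∞} (hb : ∀ n, nnExpectation P g (Zs n) ≤ b) : nnExpectation P g Z ≤ b := by
  have hcont : ContinuousOn g (Ici 0) := fun x hx => by
    rcases (mem_Ici.1 hx).eq_or_lt with rfl | hx0
    · exact hg0
    · have h1 : ContinuousOn g (Ioi 0) := by simpa using hg.continuousOn_interior
      exact (h1.continuousAt (Ioi_mem_nhds hx0)).continuousWithinAt
  calc nnExpectation P g Z ≤ ∫⁻ ω, liminf (fun n => ENNReal.ofReal (g (Zs n ω))) atTop ∂P := by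
        refine lintegral_mono_ae ?_
        filter_upwards [hlim, ae_all_iff.2 hZs0] with ω h h0
        have hZ0 : Z ω ∈ Ici (0 : ℝ) := ge_of_tendsto' h h0
        have h1 : Tendsto (fun n => g (Zs n ω)) atTop (𝓝 (g (Z ω))) :=
          (hcont _ hZ0).tendsto.comp
            (tendsto_nhdsWithin_iff.2 ⟨h, Eventually.of_forall h0⟩)
        rw [(ENNReal.tendsto_ofReal h1).liminf_eq]
    _ ≤ liminf (fun n => ∫⁻ ω, ENNReal.ofReal (g (Zs n ω)) ∂P) atTop :=
        lintegral_liminf_le' fun n => (aemeasurable_comp_of_convexOn hg (hZs n)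
          (hZs0 n)).ennreal_ofReal
    _ ≤ b := (liminf_le_liminf (Eventually.of_forall hb)).trans (by simp)

end Compactness

/-! ### Absence of strong arbitrage -/

namespace EntropicModel

variable {Ω : Type*} [MeasurableSpace Ω] {P : Measure Ω} [IsProbabilityMeasure P] {d : ℕ}
  {m : Market Ω d} {Φ g : ℝ → ℝ} {β : ℝ}

/-- The densities with loss vector of norm at most `1/(n+1)` form a decreasing sequence of nonempty
convex sets, to which the almost sure selection applies. -/
theorem exists_martingaleDensity_of_mem_closure (H : EntropicModel m P Φ g β)
    (hg0 : ContinuousWithinAt g (Ici 0) 0) (hR : ∀ i, MemOrliczHeart P Φ (m.ret i))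
    (h0 : (0 : Fin d → ℝ) ∈ closure (lossSet m P g β)) :
    ∃ Z ∈ m.martingaleDensities P, nnExpectation P g Z ≤ ENNReal.ofReal β := by
  set C : ℕ → Set (Ω → ℝ) := fun n =>
    {Z | Z ∈ entropicDualSet P g β ∧ ‖m.expectedLoss P Z‖ ≤ 1 / ((n : ℝ) + 1)} with hCdef
  have hconv : ∀ n, Convex ℝ (C n) := by
    rintro n Z ⟨hZ, hZn⟩ W ⟨hW, hWn⟩ a b ha hb hab
    refine ⟨convex_entropicDualSet H.convexOn_entropy hZ hW ha hb hab, ?_⟩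
    rw [Market.expectedLoss_convexCombo hZ.1.1 (H.integrable_mul_ret_of_mem hZ) hW.1.1
      (H.integrable_mul_ret_of_mem hW)]
    have := convex_closedBall (0 : Fin d → ℝ) (1 / ((n : ℝ) + 1))
      (mem_closedBall_zero_iff.2 hZn) (mem_closedBall_zero_iff.2 hWn) ha hb hab
    exact mem_closedBall_zero_iff.1 this
  have hne : ∀ n, (C n).Nonempty := fun n => by
    obtain ⟨_, ⟨Z, hZ, rfl⟩, hdist⟩ :=
      Metric.mem_closure_iff.1 h0 (1 / ((n : ℝ) + 1)) Nat.one_div_pos_of_nat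
    exact ⟨Z, hZ, by simpa [dist_eq_norm] using hdist.le⟩
  have hanti : Antitone C := fun n k hnk Z hZ => ⟨hZ.1, hZ.2.trans (Nat.one_div_le_one_div hnk)⟩
  obtain ⟨Zs, Z, hZsC, hlim⟩ := exists_seq_tendsto_ae_of_convex hanti hconv hne
    fun n Z hZ => hZ.1.1
  have hZs : ∀ n, AEMeasurable (Zs n) P := fun n => (hZsC n).1.1.1.aemeasurable
  have hZs0 : ∀ n, ∀ᵐ ω ∂P, 0 ≤ Zs n ω := fun n => (hZsC n).1.1.2.1
  have hZsb : ∀ n, nnExpectation P g (Zs n) ≤ ENNReal.ofReal β := fun n => (hZsC n).1.2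
  have hZ : AEMeasurable Z P := aemeasurable_of_tendsto_metrizable_ae atTop hZs hlim
  have hZ0 : ∀ᵐ ω ∂P, 0 ≤ Z ω := by
    filter_upwards [hlim, ae_all_iff.2 hZs0] with ω h h'
    exact ge_of_tendsto' h h'
  have hZb := nnExpectation_le_of_tendsto_ae H.convexOn_entropy hg0 hZs hZs0 hlim hZsb
  have htend : ∀ R, MemOrliczHeart P Φ R →
      Tendsto (fun n => ∫ ω, Zs n ω * R ω ∂P) atTop (𝓝 (∫ ω, Z ω * R ω ∂P)) := fun R hR =>
    tendsto_integral_mul_of_memOrliczHeart H.convexOn_young H.convexOn_entropy H.dominates hR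
      hZs hZs0 hZ hZ0 hlim ENNReal.ofReal_ne_top hZsb hZb
  have hZfin := hZb.trans_lt ENNReal.ofReal_lt_top
  have hZint : Integrable Z P := by
    simpa using integrable_mul_of_memOrlicz H.convexOn_young H.dominates
      (memOrliczHeart_one (P := P)).1 hZ hZ0 hZfin
  have hZ1 : ∫ ω, Z ω ∂P = 1 := by
    -- The constant `1` lies in the Orlicz heart, so no mass is lost in the limit.
    have h1 := htend 1 memOrliczHeart_one
    simp only [Pi.one_apply, mul_one, (hZsC _).1.1.2.2] at h1
    exact tendsto_nhds_unique h1 tendsto_const_nhds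
  have hZd : Z ∈ densities P := ⟨hZint, hZ0, hZ1⟩
  refine ⟨Z, H.mem_martingaleDensities hZd hZfin ?_, hZb⟩
  have hsplit : ∀ W ∈ entropicDualSet P g β, ∀ i,
      m.expectedLoss P W i = m.r - ∫ ω, W ω * m.ret i ω ∂P := fun W hW i => by
    simp only [Market.expectedLoss, mul_sub]
    rw [integral_sub (H.integrable_mul_ret_of_mem hW i) (hW.1.1.mul_const _), integral_mul_const,
      hW.1.2.2]
    ring
  have hto : Tendsto (fun n => m.expectedLoss P (Zs n)) atTop (𝓝 (m.expectedLoss P Z)) := by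
    rw [tendsto_pi_nhds]
    intro i
    rw [hsplit Z ⟨hZd, hZb⟩ i]
    simp only [hsplit _ (hZsC _).1 i]
    exact (htend _ (hR i)).const_sub _
  have hto0 : Tendsto (fun n => m.expectedLoss P (Zs n)) atTop (𝓝 0) :=
    squeeze_zero_norm (fun n => (hZsC n).2) tendsto_one_div_add_atTop_nhds_zero_nat
  exact tendsto_nhds_unique hto hto0

theorem not_strongRhoArbitrage_iff (H : EntropicModel m P Φ g β)
    (hg0 : ContinuousWithinAt g (Ici 0) 0) (hR : ∀ i, MemOrliczHeart P Φ (m.ret i)) :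
    ¬ m.StrongRhoArbitrage P (entropicRisk P g β) ↔
      ∃ Z ∈ m.martingaleDensities P, nnExpectation P g Z ≤ ENNReal.ofReal β := by
  rw [H.strongRhoArbitrage_iff]
  push Not
  constructor
  · intro h
    exact H.exists_martingaleDensity_of_mem_closure hg0 hR
      (zero_mem_closure_of_supportFun_nonneg ⟨_, H.neg_meanExcess_mem⟩ H.convex_lossSet h)
  · rintro ⟨Z, hZ, hZβ⟩ π
    have hmem : m.expectedLoss P Z ∈ lossSet m P g β := ⟨Z, ⟨hZ.1, hZβ⟩, rfl⟩
    have := dotProduct_le_supportFun H.isBounded_lossSet π hmem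
    rwa [expectedLoss_eq_zero_of_mem hZ, dotProduct_zero] at this

end EntropicModel

end MeanRisk

theorem mainTheorem11 {Ω : Type*} [MeasurableSpace Ω] (P : Measure Ω) [IsProbabilityMeasure P]
    (d : ℕ) (m : MeanRisk.Market Ω d)
    (hnonred : m.Nonredundant P) (hnondeg : m.Nondegenerate P)
    (Φ g : ℝ → ℝ) (hΦ : MeanRisk.IsFiniteYoung Φ) (hΦsup : MeanRisk.IsSuperlinear Φ)
    (hg_nonneg : ∀ y : ℝ, 0 ≤ y → 0 ≤ g y) (hg_convex : ConvexOn ℝ (Set.Ici 0) g)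
    (hg_dom : MeanRisk.DominatesConjugate g Φ)
    (β : ℝ) (hβ : g 1 < β)
    (hR : ∀ i, MeanRisk.MemOrlicz P Φ (m.ret i)) :
    (∀ ν : ℝ, 0 ≤ ν →
      (m.optimalPortfolios P (MeanRisk.entropicRisk P g β) ν).Nonempty ∧
      IsCompact (m.optimalPortfolios P (MeanRisk.entropicRisk P g β) ν) ∧
      Convex ℝ (m.optimalPortfolios P (MeanRisk.entropicRisk P g β) ν)) ∧
    (ContinuousWithinAt g (Set.Ici 0) 0 →
      (∀ i, MeanRisk.MemOrliczHeart P Φ (m.ret i)) →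
      (¬ m.StrongRhoArbitrage P (MeanRisk.entropicRisk P g β) ↔
        ∃ Z ∈ m.martingaleDensities P,
          MeanRisk.nnExpectation P g Z ≤ ENNReal.ofReal β)) ∧
    (¬ m.RhoArbitrage P (MeanRisk.entropicRisk P g β) ↔
      ∃ Z ∈ m.equivalentMartingaleDensities P,
        MeanRisk.nnExpectation P g Z < ENNReal.ofReal β) := by
  have H : MeanRisk.EntropicModel m P Φ g β :=
    ⟨hnonred, hnondeg, hΦ.convexOn, hg_convex, hg_nonneg, hg_dom, hβ, hR⟩
  exact ⟨fun ν _ => H.optimalPortfolios_nonempty_compact_convex ν,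
    fun hg0 hRH => H.not_strongRhoArbitrage_iff hg0 hRH, H.not_rhoArbitrage_iff⟩
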